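/- **Problem.** Let $(\mathbb E_1,\|\cdot\|)$, $(\mathbb E_2,\|\cdot\|)$ be finite-dimensional real normed spaces, $\mathcal X\subseteq\mathbb E_1$, $\Lambda\subseteq\mathbb E_2$ nonempty, convex, closed and bounded, and $$\min_{x\in\mathcal X}\max_{\lambda\in\Lambda}\; S(x,\lambda)=f(x)+g(x)+\Phi(x,\lambda)-h(\lambda),\qquad \Phi=\tfrac1n\sum_{i=1}^n\Phi_i,\quad n\ge 1 .$$ Here $g$ and $h$ are convex, lower semicontinuous and finite on $\mathcal X$ and $\Lambda$; $f$ is differentiable on an open set containing $\mathcal X$ with $\frac\mu2\|x-x'\|^2\le f(x)-f(x')-\langle\nabla f(x'),x-x'\rangle\le\frac L2\|x-x'\|^2$ on $\mathcal X$ ($L\ge\mu>0$); every $\Phi_i$ is convex and differentiable in $x$ and concave and differentiable in $\lambda$; and on $\mathcal X\times\Lambda$, in the dual norms, $\nabla_x\Phi$ is $L_{xx}$-Lipschitz in $x$ and $L_{\lambda x}$-Lipschitz in $\lambda$, and $\nabla_\lambda\Phi$ is $L_{\lambda x}$-Lipschitz in $x$ and $L_{\lambda\lambda}$-Lipschitz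 in $\lambda$, with $L_{xx},L_{\lambda x},L_{\lambda\lambda}\ge0$. Put $\kappa_{\mathcal X}=(L+L_{xx})/\mu$ and $L_{\mathrm D}=L_{\lambda\lambda}+2L_{\lambda x}^2/\mu$, and assume $L_{\mathrm D}>0$. Let $\omega$ be continuous and $1$-strongly convex on $\Lambda$ (for instance a distance generating function), $B_{\omega,\Lambda}=\sup_\Lambda|\omega|$, and let $\Delta(x,\lambda)=\sup_{\lambda'\in\Lambda}S(x,\lambda')-\inf_{x'\in\mathcal X}S(x',\lambda)$ be the duality gap. **Oracles.** One primal oracle call returns $\nabla f(x)$ or one $\nabla_x\Phi_i(x,\lambda)$; one dual oracle call returns one $\nabla_\lambda\Phi_i(x,\lambda)$. **Algorithm 1 (inexact primal-dual smoothing).** Given $x^0\in\mathcal X$, $\lambda^0\in\Lambda$ and $\varepsilon>0$, let $\rho_0=8L_{\mathrm D}$, $\tau_k=\frac{k+1}{k+3}$, $\gamma_k=\eta_k=\frac{\varepsilon}{4(k+3)}$, $\rho_{k+1}=\tau_k\rho_k$, and for $k=0,1,\dots$ 1. compute $\tilde\lambda\in\Lambda$ maximizing $\Phi(x^k,\cdot)-h-\rho_k\omega$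 over $\Lambda$ up to $\eta_k$, and set $\hat\lambda^k=\tau_k\lambda^k+(1-\tau_k)\tilde\lambda$; 2. compute $\tilde x\in\mathcal X$ minimizing $f+g+\Phi(\cdot,\hat\lambda^k)$ over $\mathcal X$ up to $\gamma_k$, and set $x^{k+1}=\tau_kx^k+(1-\tau_k)\tilde x$; 3. compute $\tilde\lambda'\in\Lambda$ maximizing $\Phi(x^{k+1},\cdot)-h-\rho_{k+1}\omega$ over $\Lambda$ up to $\eta_k$, and set $\lambda^{k+1}=\tau_k\lambda^k+(1-\tau_k)\tilde\lambda'$. **Subproblem solver.** Fix inner products on $\mathbb E_1,\mathbb E_2$ whose norms satisfy $\|u\|\le|u|\le\theta_j\|u\|$ on $\mathbb E_j$, with $\theta_j\ge 1$ (if $\|\cdot\|$ is Euclidean, take $|\cdot|=\|\cdot\|$ and $\theta_j=1$). A problem $\min_{u\in U}\phi_1(u)+\phi_2(u)$ with $\phi_1$ convex and $L'$-smooth and $\phi_2$ $\mu'$-strongly convex with respect to $|\cdot|$ is solved by Nesterov's accelerated proximal gradient method: from any $u^0\in U$, with $A_0=0$ and $\psi_0(u)=\frac12|u-u^0|^2$,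 iterate $$v=\arg\min_U\psi_k,\quad \frac{a^2}{A_k+a}=\frac{2(1+\mu'A_k)}{L'}\ (a>0),\quad y=\frac{A_ku^k+av}{A_k+a},$$ $$u^{k+1}=\arg\min_{u\in U}\langle\nabla\phi_1(y),u\rangle+\tfrac{L'}2|u-y|^2+\phi_2(u),$$ $$A_{k+1}=A_k+a,\quad \psi_{k+1}(u)=\psi_k(u)+a[\phi_1(u^{k+1})+\langle\nabla\phi_1(u^{k+1}),u-u^{k+1}\rangle+\phi_2(u)],$$ (if $L'=0$, take $y=u^0$ and stop after one iteration). For accuracy $\alpha$ on a set $U$ of diameter $D_U$ in the norm $\|\cdot\|$ it is run for the least $N\ge1$ with $\frac{L'}4\bigl(1+\sqrt{\mu'/(2L')}\bigr)^{-2(N-1)}(\theta D_U)^2\le\alpha$, where $\theta=\theta_j$ for $U\subseteq\mathbb E_j$. For the dual subproblems $\phi_1=-\Phi(x,\cdot)$, $\phi_2=h+\rho\omega$, $L'=L_{\lambda\lambda}$, $\mu'=\rho/\theta_2^2$. For the primal ones $m=\mu/\theta_1^2$, $\phi_1=f+\Phi(\cdot,\lambda)-\frac m2|\cdot-u^0|^2$,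 $\phi_2=g+\frac m2|\cdot-u^0|^2$, $L'=L+L_{xx}$, $\mu'=m$. **Theorem.** There is an absolute constant $C>0$ with the following property. Let constants $\mu,L,L_{xx},L_{\lambda x},L_{\lambda\lambda}$ as above be given, as well as $\theta_1,\theta_2\ge 1$ and $b,D,\Delta_0\ge0$. Then there is $\varepsilon_0>0$, depending only on these numbers, such that for all spaces, inner products and problems with these constants for which $B_{\omega,\Lambda}\le b$ and $\mathcal X,\Lambda$ have diameter at most $D$, all starting points $(x^0,\lambda^0)\in\mathcal X\times\Lambda$ with $\Delta(x^0,\lambda^0)\le\Delta_0$, all choices of starting points of the inner method in $\mathcal X$ and $\Lambda$, and all $0<\varepsilon\le\varepsilon_0$: in every iteration the inner method returns points of $\Lambda$, $\mathcal X$, $\Lambda$ that satisfy the accuracy requirements of steps 1, 2 and 3, and there is $K$ such that $(x^K,\lambda^K)\in\mathcal X\times\Lambda$, $\Delta(x^K,\lambda^K)\le\varepsilon$, and the numbers $C^{\mathrm P}_{\mathsf{det}}$ and $C^{\mathrm D}_{\mathsf{det}}$ of primal and dual oracle calls made in the first $K$ iterations satisfy $$C^{\mathrm P}_{\mathsf{det}}\le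 C\,\theta_1\sqrt{1+b+\Delta_0/L_{\mathrm D}}\;\cdot n\sqrt{\frac{\kappa_{\mathcal X}L_{\mathrm D}}{\varepsilon}}\,\log\frac{(L+L_{xx})L_{\mathrm D}}{\varepsilon},$$ and, if $L_{\lambda\lambda}>0$, $$C^{\mathrm D}_{\mathsf{det}}\le C\,\theta_2\bigl(1+b+\Delta_0/L_{\mathrm D}\bigr)\cdot n\,\frac{\sqrt{L_{\lambda\lambda}L_{\mathrm D}}}{\varepsilon}\,\log\frac{L_{\lambda\lambda}L_{\mathrm D}}{\varepsilon}.$$ -/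

import Mathlib

open Set

universe u v

noncomputable section

namespace IPDS

/-- The data of the saddle point problem
`min_{x ∈ X} max_{l ∈ Λ} S(x,l) = f(x) + g(x) + Φ(x,l) - h(l)`, `Φ = (1/n) ∑ i, Φ_i`, together with
the function `ω` used to regularize the dual variable. An extended-real-valued closed convex
function that is finite on the constraint set is given by its (real) values on that set; the values
of `f, g` off `X` and of `h, ω` off `Λ` are never used. -/
structure SaddleProblem (E₁ : Type u) (E₂ : Type v) where
  /-- number of components of the coupling term -/
  n : ℕ
  X : Set E₁
  Λ : Set E₂
  f : E₁ → ℝ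
  g : E₁ → ℝ
  h : E₂ → ℝ
  ω : E₂ → ℝ
  Φi : Fin n → E₁ → E₂ → ℝ

/-- The strong convexity and smoothness constants of a saddle point problem. -/
structure Constants where
  /-- strong convexity of `f` -/
  μ : ℝ
  /-- smoothness of `f` -/
  L : ℝ
  Lxx : ℝ
  Llx : ℝ
  Lll : ℝ

/-- `L_D = L_{λλ} + 2 L_{λx}² / μ`. -/
def Constants.LD (c : Constants) : ℝ := c.Lll + 2 * c.Llx ^ 2 / c.μ

/-- The primal condition number `κ_X = (L + L_{xx}) / μ`. -/
def Constants.kappa (c : Constants) : ℝ := (c.L + c.Lxx) / c.μ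

/-- Standing conditions on the constants. The initial smoothing parameter of the algorithm is
`8 * L_D` and has to be positive. -/
structure Constants.Valid (c : Constants) : Prop where
  mu_pos : 0 < c.μ
  mu_le : c.μ ≤ c.L
  Lxx_nonneg : 0 ≤ c.Lxx
  Llx_nonneg : 0 ≤ c.Llx
  Lll_nonneg : 0 ≤ c.Lll
  LD_pos : 0 < c.LD

namespace SaddleProblem

section Functions

variable {E₁ : Type u} {E₂ : Type v} (P : SaddleProblem E₁ E₂)

/-- `Φ = (1/n) ∑ i, Φ_i` -/
def Φ (x : E₁) (l : E₂) : ℝ := (1 / (P.n : ℝ)) * ∑ i, P.Φi i x l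

/-- The saddle function. -/
def S (x : E₁) (l : E₂) : ℝ := P.f x + P.g x + P.Φ x l - P.h l

/-- `Ŝᴾ(x,l) = f(x) + g(x) + Φ(x,l)`: objective of the primal subproblem. -/
def SP (x : E₁) (l : E₂) : ℝ := P.f x + P.g x + P.Φ x l

/-- `Ŝᴰ_ρ(x,l) = Φ(x,l) - h(l) - ρ ω(l)`: objective of the smoothed dual subproblem. -/
def SD (ρ : ℝ) (x : E₁) (l : E₂) : ℝ := P.Φ x l - P.h l - ρ * P.ω l

/-- The optimal value `ψ̂ᴰ(l) = inf_{x ∈ X} Ŝᴾ(x,l)`. Under the standing assumptions this and the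
following infima and suprema are over nonempty compact sets of semicontinuous functions, hence
finite for arguments in the constraint sets. -/
def psiHatD (l : E₂) : ℝ := sInf ((fun x => P.SP x l) '' P.X)

/-- The optimal value `ψ̂ᴾ_ρ(x) = sup_{l ∈ Λ} Ŝᴰ_ρ(x,l)`. -/
def psiHatP (ρ : ℝ) (x : E₁) : ℝ := sSup ((fun l => P.SD ρ x l) '' P.Λ)

/-- The primal function. -/
def psiP (x : E₁) : ℝ := sSup ((fun l => P.S x l) '' P.Λ)

/-- The dual function. -/
def psiD (l : E₂) : ℝ := sInf ((fun x => P.S x l) '' P.X)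

/-- The duality gap. -/
def gap (x : E₁) (l : E₂) : ℝ := P.psiP x - P.psiD l

/-- `γ`-inexact solution of the primal subproblem at `l`. -/
def IsInexactPrimal (γ : ℝ) (l : E₂) (x : E₁) : Prop :=
  x ∈ P.X ∧ P.SP x l - P.psiHatD l ≤ γ

/-- `η`-inexact solution of the smoothed dual subproblem at `x`. -/
def IsInexactDual (ρ η : ℝ) (x : E₁) (l : E₂) : Prop :=
  l ∈ P.Λ ∧ P.psiHatP ρ x - P.SD ρ x l ≤ η

end Functions

section Assumptions

variable {E₁ : Type u} [NormedAddCommGroup E₁] [NormedSpace ℝ E₁]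
  {E₂ : Type v} [NormedAddCommGroup E₂] [NormedSpace ℝ E₂]

/-- `∇_x Φ(x,l)`, an element of the dual of `E₁`. -/
def gradX (P : SaddleProblem E₁ E₂) (x : E₁) (l : E₂) : E₁ →L[ℝ] ℝ :=
  fderiv ℝ (fun z => P.Φ z l) x

/-- `∇_λ Φ(x,l)`, an element of the dual of `E₂`. -/
def gradL (P : SaddleProblem E₁ E₂) (x : E₁) (l : E₂) : E₂ →L[ℝ] ℝ :=
  fderiv ℝ (fun z => P.Φ x z) l

/-- The assumptions on the saddle point problem. Norms of functionals are dual norms. -/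
structure Admissible (P : SaddleProblem E₁ E₂) (c : Constants) : Prop where
  n_pos : 0 < P.n
  X_nonempty : P.X.Nonempty
  X_convex : Convex ℝ P.X
  X_closed : IsClosed P.X
  X_bounded : Bornology.IsBounded P.X
  Λ_nonempty : P.Λ.Nonempty
  Λ_convex : Convex ℝ P.Λ
  Λ_closed : IsClosed P.Λ
  Λ_bounded : Bornology.IsBounded P.Λ
  f_differentiable : ∃ X' : Set E₁, IsOpen X' ∧ P.X ⊆ X' ∧ DifferentiableOn ℝ P.f X'
  f_strongly_convex : ∀ x ∈ P.X, ∀ x' ∈ P.X,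
    c.μ / 2 * ‖x - x'‖ ^ 2 ≤ P.f x - P.f x' - fderiv ℝ P.f x' (x - x')
  f_smooth : ∀ x ∈ P.X, ∀ x' ∈ P.X,
    P.f x - P.f x' - fderiv ℝ P.f x' (x - x') ≤ c.L / 2 * ‖x - x'‖ ^ 2
  g_convex : ConvexOn ℝ P.X P.g
  g_closed : LowerSemicontinuousOn P.g P.X
  h_convex : ConvexOn ℝ P.Λ P.h
  h_closed : LowerSemicontinuousOn P.h P.Λ
  ω_continuous : ContinuousOn P.ω P.Λ
  ω_strongly_convex : StrongConvexOn P.Λ 1 P.ω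
  Φi_convex : ∀ i l, ConvexOn ℝ univ (fun x => P.Φi i x l)
  Φi_differentiable_left : ∀ i l, Differentiable ℝ (fun x => P.Φi i x l)
  Φi_concave : ∀ i x, ConcaveOn ℝ univ (fun l => P.Φi i x l)
  Φi_differentiable_right : ∀ i x, Differentiable ℝ (fun l => P.Φi i x l)
  smooth_xx : ∀ x ∈ P.X, ∀ x' ∈ P.X, ∀ l ∈ P.Λ,
    ‖P.gradX x l - P.gradX x' l‖ ≤ c.Lxx * ‖x - x'‖
  smooth_xl : ∀ x ∈ P.X, ∀ l ∈ P.Λ, ∀ l' ∈ P.Λ,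
    ‖P.gradX x l - P.gradX x l'‖ ≤ c.Llx * ‖l - l'‖
  smooth_lx : ∀ x ∈ P.X, ∀ x' ∈ P.X, ∀ l ∈ P.Λ,
    ‖P.gradL x l - P.gradL x' l‖ ≤ c.Llx * ‖x - x'‖
  smooth_ll : ∀ x ∈ P.X, ∀ l ∈ P.Λ, ∀ l' ∈ P.Λ,
    ‖P.gradL x l - P.gradL x l'‖ ≤ c.Lll * ‖l - l'‖

end Assumptions

end SaddleProblem

/-! ### Oracles and the counting of oracle calls -/

/-- A value together with the number of oracle calls made to compute it. -/
structure Counted (α : Type u) where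
  val : α
  calls : ℕ

instance : Monad Counted where
  pure a := ⟨a, 0⟩
  bind p k := ⟨(k p.val).val, p.calls + (k p.val).calls⟩

/-- Sum of the results of `n` counted computations. -/
def Counted.sum {V : Type u} [AddCommMonoid V] {n : ℕ} (p : Fin n → Counted V) : Counted V :=
  ⟨∑ i, (p i).val, ∑ i, (p i).calls⟩

section Oracles

variable {E₁ : Type u} [NormedAddCommGroup E₁] [NormedSpace ℝ E₁]
  {E₂ : Type v} [NormedAddCommGroup E₂] [NormedSpace ℝ E₂]

/-- The primal oracle: one call returns `∇_x Φ_i(x,l)` (query `some i`) or `∇ f(x)`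
(query `none`). -/
def primalOracle (P : SaddleProblem E₁ E₂) (x : E₁) (l : E₂) :
    Option (Fin P.n) → Counted (E₁ →L[ℝ] ℝ)
  | none => ⟨fderiv ℝ P.f x, 1⟩
  | some i => ⟨fderiv ℝ (fun z => P.Φi i z l) x, 1⟩

/-- The dual oracle: one call returns `∇_λ Φ_i(x,l)`. -/
def dualOracle (P : SaddleProblem E₁ E₂) (x : E₁) (l : E₂) (i : Fin P.n) :
    Counted (E₂ →L[ℝ] ℝ) :=
  ⟨fderiv ℝ (fun z => P.Φi i x z) l, 1⟩

end Oracles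

/-! ### The accelerated proximal gradient method -/

/-- `B` is an inner product whose norm `|u| = √(B u u)` satisfies `‖u‖ ≤ |u| ≤ θ ‖u‖`. -/
structure IsEuclidean {E : Type u} [NormedAddCommGroup E] [NormedSpace ℝ E]
    (B : E →L[ℝ] E →L[ℝ] ℝ) (θ : ℝ) : Prop where
  symm : ∀ u w, B u w = B w u
  lower : ∀ u, ‖u‖ ^ 2 ≤ B u u
  upper : ∀ u, B u u ≤ θ ^ 2 * ‖u‖ ^ 2

/-- A minimizer of `F` over `U` (if there is one). -/
def argminOn {E : Type u} [Nonempty E] (U : Set E) (F : E → ℝ) : E :=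
  Classical.epsilon fun z => z ∈ U ∧ IsMinOn F U z

section APG

variable {E : Type u} [NormedAddCommGroup E] [NormedSpace ℝ E]

/-- State of the accelerated method: the scaling coefficient `A_k = ∑ a_i`, the iterate `x_k`, and
the accumulated linear form `s_k = ∑ a_i ∇φ₁(x_i)`. Up to an additive constant the estimate function
is `ψ_k(u) = ½|u - u₀|² + s_k(u) + A_k φ₂(u)`. -/
structure APGState (E : Type u) [NormedAddCommGroup E] [NormedSpace ℝ E] where
  A : ℝ
  x : E
  s : E →L[ℝ] ℝ

/-- Input of the accelerated method for `min_{u ∈ U} φ₁(u) + φ₂(u)`: the function `φ₁` is accessed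
through its gradient only; `L` is its smoothness constant and `μ` the strong convexity constant of
`φ₂`, with respect to the Euclidean norm given by `B`; `u₀` is the starting point. -/
structure APGInput (E : Type u) [NormedAddCommGroup E] [NormedSpace ℝ E] where
  B : E →L[ℝ] E →L[ℝ] ℝ
  U : Set E
  grad : E → Counted (E →L[ℝ] ℝ)
  φ₂ : E → ℝ
  L : ℝ
  μ : ℝ
  u₀ : E

/-- The positive root `a` of `a² / (A + a) = 2 (1 + μ A) / L`. -/
def apgCoeff (L μ A : ℝ) : ℝ :=
  (2 * (1 + μ * A) / L + √((2 * (1 + μ * A) / L) ^ 2 + 4 * (2 * (1 + μ * A) / L) * A)) / 2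

/-- One iteration, with the step parameter `L` (no backtracking):
`v = argmin ψ_k`, `y = (A x + a v) / (A + a)`,
`x⁺ = argmin_{u ∈ U} ⟨∇φ₁(y), u⟩ + (L/2)|u - y|² + φ₂(u)`, and
`ψ_{k+1}(u) = ψ_k(u) + a [φ₁(x⁺) + ⟨∇φ₁(x⁺), u - x⁺⟩ + φ₂(u)]`.
If `L = 0` (`φ₁` affine on `U`) the first iteration has `y = u₀` and `x⁺` is an exact solution. -/
def apgStep (I : APGInput E) (st : APGState E) : Counted (APGState E) := do
  let a := apgCoeff I.L I.μ st.A
  let w := argminOn I.U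
    (fun u => 1 / 2 * I.B (u - I.u₀) (u - I.u₀) + st.s u + st.A * I.φ₂ u)
  let y := st.x + (a / (st.A + a)) • (w - st.x)
  let gy ← I.grad y
  let x' := argminOn I.U (fun u => gy u + I.L / 2 * I.B (u - y) (u - y) + I.φ₂ u)
  let gx ← I.grad x'
  return { A := st.A + a, x := x', s := st.s + a • gx }

/-- The state after a given number of iterations. -/
def apgRun (I : APGInput E) : ℕ → Counted (APGState E)
  | 0 => pure { A := 0, x := I.u₀, s := 0 }
  | N + 1 => do
      let st ← apgRun I N
      apgStep I st

/-- The number of iterations that the method is run to reach accuracy `acc` on a set of diameter at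
most `D`: the least `N ≥ 1` with `(L/4) (1 + √(μ/(2L)))^(-2(N-1)) D² ≤ acc`. -/
def apgIterations (L μ D acc : ℝ) : ℕ :=
  sInf {N : ℕ | 1 ≤ N ∧ L / 4 * D ^ 2 ≤ acc * (1 + √(μ / (2 * L))) ^ (2 * (N - 1))}

/-- The accelerated method with that number of iterations. -/
def apgSolve (I : APGInput E) (D acc : ℝ) : Counted E := do
  let st ← apgRun I (apgIterations I.L I.μ D acc)
  return st.x

end APG

/-! ### The inexact primal-dual smoothing algorithm -/

section Algorithm

variable {E₁ : Type u} [NormedAddCommGroup E₁] [NormedSpace ℝ E₁]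
  {E₂ : Type v} [NormedAddCommGroup E₂] [NormedSpace ℝ E₂]

/-- Input of the algorithm: the problem and its constants; for each space the inner product used by
the accelerated method, with its distortion `θ`; the initial smoothing parameter, the interpolation
sequence and the error sequences; the starting point; and the starting points of the inner method
in the three subproblems of each iteration. -/
structure Input (E₁ : Type u) [NormedAddCommGroup E₁] [NormedSpace ℝ E₁]
    (E₂ : Type v) [NormedAddCommGroup E₂] [NormedSpace ℝ E₂] where
  P : SaddleProblem E₁ E₂
  c : Constants
  B₁ : E₁ →L[ℝ] E₁ →L[ℝ] ℝ
  θ₁ : ℝ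
  B₂ : E₂ →L[ℝ] E₂ →L[ℝ] ℝ
  θ₂ : ℝ
  ρ₀ : ℝ
  τ : ℕ → ℝ
  γ : ℕ → ℝ
  η : ℕ → ℝ
  x₀ : E₁
  l₀ : E₂
  innerX : ℕ → E₁
  innerL : ℕ → E₂
  innerL' : ℕ → E₂

/-- The dual subproblem at `x`, i.e. `min_{l ∈ Λ} -Φ(x,l) + (h(l) + ρ ω(l))`, as an input of the
accelerated method started at `start`. -/
def dualInput (I : Input E₁ E₂) (ρ : ℝ) (start : E₂) (x : E₁) : APGInput E₂ where
  B := I.B₂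
  U := I.P.Λ
  grad l := do
    let s ← Counted.sum (fun i => dualOracle I.P x l i)
    return -((1 / (I.P.n : ℝ)) • s)
  φ₂ l := I.P.h l + ρ * I.P.ω l
  L := I.c.Lll
  μ := ρ / I.θ₂ ^ 2
  u₀ := start

/-- Approximate solution of the dual subproblem to accuracy `η`. -/
def solveDual (I : Input E₁ E₂) (ρ η : ℝ) (start : E₂) (x : E₁) : Counted E₂ :=
  apgSolve (dualInput I ρ start x) (I.θ₂ * Metric.diam I.P.Λ) η

/-- The primal subproblem at `l`, i.e. `min_{x ∈ X} (f(x) + Φ(x,l)) + g(x)`, as an input of the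
accelerated method started at `start`. The strong convexity of `f` is moved to the second term: with
`m = μ/θ₁²`, `φ₁(x) = f(x) + Φ(x,l) - (m/2)|x - start|²` and `φ₂(x) = g(x) + (m/2)|x - start|²`. -/
def primalInput (I : Input E₁ E₂) (start : E₁) (l : E₂) : APGInput E₁ where
  B := I.B₁
  U := I.P.X
  grad x := do
    let df ← primalOracle I.P x l none
    let s ← Counted.sum (fun i => primalOracle I.P x l (some i))
    return df + (1 / (I.P.n : ℝ)) • s - (I.c.μ / I.θ₁ ^ 2) • I.B₁ (x - start)
  φ₂ x := I.P.g x + I.c.μ / I.θ₁ ^ 2 / 2 * I.B₁ (x - start) (x - start)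
  L := I.c.L + I.c.Lxx
  μ := I.c.μ / I.θ₁ ^ 2
  u₀ := start

/-- Approximate solution of the primal subproblem to accuracy `γ`. -/
def solvePrimal (I : Input E₁ E₂) (γ : ℝ) (start : E₁) (l : E₂) : Counted E₁ :=
  apgSolve (primalInput I start l) (I.θ₁ * Metric.diam I.P.X) γ

/-- State of the algorithm, with the total numbers of oracle calls made so far. -/
structure State (E₁ : Type u) (E₂ : Type v) where
  x : E₁
  l : E₂
  ρ : ℝ
  primalCalls : ℕ
  dualCalls : ℕ

/-- First step of iteration `k`: approximate dual solution at `x^k`. -/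
def stepDual₁ (I : Input E₁ E₂) (k : ℕ) (st : State E₁ E₂) : Counted E₂ :=
  solveDual I st.ρ (I.η k) (I.innerL k) st.x

/-- The point `λ̂^k`. -/
def lamHat (I : Input E₁ E₂) (k : ℕ) (st : State E₁ E₂) : E₂ :=
  I.τ k • st.l + (1 - I.τ k) • (stepDual₁ I k st).val

/-- Approximate primal solution at `λ̂^k`. -/
def stepPrimal (I : Input E₁ E₂) (k : ℕ) (st : State E₁ E₂) : Counted E₁ :=
  solvePrimal I (I.γ k) (I.innerX k) (lamHat I k st)

/-- The point `x^{k+1}`. -/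
def nextX (I : Input E₁ E₂) (k : ℕ) (st : State E₁ E₂) : E₁ :=
  I.τ k • st.x + (1 - I.τ k) • (stepPrimal I k st).val

/-- Approximate dual solution at `x^{k+1}`, with smoothing parameter `ρ_{k+1} = τ_k ρ_k`. -/
def stepDual₂ (I : Input E₁ E₂) (k : ℕ) (st : State E₁ E₂) : Counted E₂ :=
  solveDual I (I.τ k * st.ρ) (I.η k) (I.innerL' k) (nextX I k st)

/-- The state after a given number of iterations. -/
def run (I : Input E₁ E₂) : ℕ → State E₁ E₂
  | 0 => { x := I.x₀, l := I.l₀, ρ := I.ρ₀, primalCalls := 0, dualCalls := 0 }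
  | k + 1 =>
      let st := run I k
      { x := nextX I k st
        l := I.τ k • st.l + (1 - I.τ k) • (stepDual₂ I k st).val
        ρ := I.τ k * st.ρ
        primalCalls := st.primalCalls + (stepPrimal I k st).calls
        dualCalls := st.dualCalls + (stepDual₁ I k st).calls + (stepDual₂ I k st).calls }

/-- The subproblems of all iterations are solved to the prescribed accuracies. -/
def SubproblemsSolved (I : Input E₁ E₂) : Prop :=
  ∀ k : ℕ,
    I.P.IsInexactDual (run I k).ρ (I.η k) (run I k).x (stepDual₁ I k (run I k)).val ∧
    I.P.IsInexactPrimal (I.γ k) (lamHat I k (run I k)) (stepPrimal I k (run I k)).val ∧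
    I.P.IsInexactDual (run I (k + 1)).ρ (I.η k) (run I (k + 1)).x (stepDual₂ I k (run I k)).val

/-- The choice of the parameters for target accuracy `ε`:
`ρ₀ = 8 L_D`, `τ_k = (k+1)/(k+3)`, `γ_k = η_k = ε/(4(k+3))`. -/
structure Input.HasParameters (I : Input E₁ E₂) (ε : ℝ) : Prop where
  ρ₀_eq : I.ρ₀ = 8 * I.c.LD
  τ_eq : ∀ k : ℕ, I.τ k = ((k : ℝ) + 1) / ((k : ℝ) + 3)
  γ_eq : ∀ k : ℕ, I.γ k = ε / (4 * ((k : ℝ) + 3))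
  η_eq : ∀ k : ℕ, I.η k = ε / (4 * ((k : ℝ) + 3))

/-- The assumptions on the input. -/
structure Input.Admissible (I : Input E₁ E₂) : Prop where
  problem : I.P.Admissible I.c
  euclidean₁ : IsEuclidean I.B₁ I.θ₁
  euclidean₂ : IsEuclidean I.B₂ I.θ₂
  x₀_mem : I.x₀ ∈ I.P.X
  l₀_mem : I.l₀ ∈ I.P.Λ
  innerX_mem : ∀ k, I.innerX k ∈ I.P.X
  innerL_mem : ∀ k, I.innerL k ∈ I.P.Λ
  innerL'_mem : ∀ k, I.innerL' k ∈ I.P.Λ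

end Algorithm

end IPDS

end

/-! The outer loop is governed by the smoothed gap, in which the primal function is regularized by
`ρ ω`. Dropping the regularization changes the gap by at most `ρ b`. The function `psiHatD` is
concave, and an inexact primal solution at `λ̂` yields a first-order model of it with curvature `LD`
and error `2γ`. If `LD (1 - τ)² ≤ τρ/4`, the strong concavity of the regularized dual problem pays
for this curvature, so one iteration multiplies the smoothed gap by `τ`, up to subproblem errors
(`smoothedGap_step`). For the chosen parameters `(k+1)(k+2)(smoothed gap - ε/2)` does not increase
and `ρ_k = 16 LD / ((k+1)(k+2))`. With `q = 1 + b + Δ₀/LD` and `R = √(LD q / ε)`, about `8R` outer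
iterations suffice.

The inner method is analysed with Nesterov's estimate sequence: `A φ(x)` stays below the minimum of
`ψ`, which is at most `½|u - u₀|² + A φ(u)` at any `u`. Since `ψ` uses gradients at the new
iterates, preserving this needs cocoercivity of the gradient. Smoothness is only available on the
constraint set, which may have empty interior, so cocoercivity is proved only in directions of `U -
U` (`ConvexSmoothOn.cocoercive`); the step is arranged so that no other direction occurs. The
coefficients `A` grow geometrically, which gives linear convergence.

For the count, a primal solve takes `O(θ₁ √κ log)` inner iterations. A dual solve takes `O(θ₂
√(Lll/ρ_k) log)`, which grows linearly in `k`; summing over `k ≤ K` gives order `K √κ` and `K²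
√(Lll/LD)` respectively. The diameter, the distortions and `q` disappear from the logarithm because,
for small `ε`, the ratio of initial error to accuracy is at most the fourth power of the argument of
the logarithm. -/

namespace IPDS

/-! ### Cocoercivity of gradients on a convex set without interior -/

section Cocoercivity

variable {E : Type u} [NormedAddCommGroup E] [NormedSpace ℝ E]

/-- On `U`, `φ` lies above its linearizations given by `G`, and at most `(L/2)|·|²` above them,
where `|u|² = B u u`. -/
structure ConvexSmoothOn (B : E →L[ℝ] E →L[ℝ] ℝ) (U : Set E) (φ : E → ℝ)
    (G : E → E →L[ℝ] ℝ) (L : ℝ) : Prop where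
  lower : ∀ x ∈ U, ∀ y ∈ U, φ y + G y (x - y) ≤ φ x
  upper : ∀ x ∈ U, ∀ y ∈ U, φ x ≤ φ y + G y (x - y) + L / 2 * B (x - y) (x - y)

theorem combo_four_mem {U : Set E} (hU : Convex ℝ U) {x y u v : E} (hx : x ∈ U) (hy : y ∈ U)
    (hu : u ∈ U) (hv : v ∈ U) {a b c d : ℝ} (ha : 0 ≤ a) (hb : 0 ≤ b) (hc : 0 ≤ c) (hd : 0 ≤ d)
    (h : a + b + c + d = 1) : a • x + b • y + c • u + d • v ∈ U := by
  have := hU.sum_mem (t := Finset.univ) (w := ![a, b, c, d]) (z := ![x, y, u, v])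
    (by intro i _; fin_cases i <;> simpa) (by simp [Fin.sum_univ_four, h])
    (by intro i _; fin_cases i <;> simpa)
  simpa [Fin.sum_univ_four] using this

variable {B : E →L[ℝ] E →L[ℝ] ℝ} {U : Set E} {φ : E → ℝ} {G : E → E →L[ℝ] ℝ} {L : ℝ}

namespace ConvexSmoothOn

/-- At `q + t w` the linearization at `p` lies below the quadratic upper bound at `q`; at `p - t w`
the roles are exchanged. Adding the two comparisons cancels all values of `φ`. -/
theorem grad_sub_two_points (h : ConvexSmoothOn B U φ G L) {p q w : E} {t : ℝ} (hp : p ∈ U)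
    (hq : q ∈ U) (hq' : q + t • w ∈ U) (hp' : p - t • w ∈ U) :
    0 ≤ (G q - G p) (q - p) + 2 * t * (G q - G p) w + L * t ^ 2 * B w w := by
  have h1 := h.lower _ hq' p hp
  have h2 := h.upper _ hq' q hq
  have h3 := h.lower _ hp' q hq
  have h4 := h.upper _ hp' p hp
  have e1 : q + t • w - p = (q - p) + t • w := by abel
  have e2 : q + t • w - q = t • w := by abel
  have e3 : p - t • w - q = -(q - p) - t • w := by abel
  have e4 : p - t • w - p = -(t • w) := by abel
  rw [e1] at h1; rw [e2] at h2; rw [e3] at h3; rw [e4] at h4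
  simp only [map_add, map_sub, map_neg, map_smul, smul_eq_mul, neg_apply,
    smul_apply, sub_apply] at *
  nlinarith

/-- Used with both signs of `t`, and with `t` and `q - p` of the same order `δ`, this gives
continuity of `G` in the direction `w` with rate `O(δ)`. -/
theorem grad_sub_le (h : ConvexSmoothOn B U φ G L) {p q w : E} {t : ℝ} (hp : p ∈ U)
    (hq : q ∈ U) (hq' : q + t • w ∈ U) :
    -(t * (G q - G p) w) ≤ L / 2 * B (q - p) (q - p) + L / 2 * t ^ 2 * B w w := by
  have h1 := h.lower _ hq' p hp
  have h2 := h.upper _ hq' q hq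
  have h3 := h.upper q hq p hp
  have e1 : q + t • w - p = (q - p) + t • w := by abel
  have e2 : q + t • w - q = t • w := by abel
  rw [e1] at h1; rw [e2] at h2
  simp only [map_add, map_smul, smul_eq_mul,
    smul_apply, sub_apply] at *
  nlinarith

/-- The cocoercivity inequality tested in a direction in which one can move from `x` and `y`. -/
theorem cocoercive_of_room (h : ConvexSmoothOn B U φ G L) (hU : Convex ℝ U) {x y w : E} {T : ℝ}
    (hT : 0 < T) (hx : ∀ t, |t| ≤ T → x + t • w ∈ U) (hy : ∀ t, |t| ≤ T → y + t • w ∈ U) (s : ℝ) :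
    0 ≤ (G y - G x) (y - x) + 2 * s * (G y - G x) w + L * s ^ 2 * B w w := by
  -- The required displacement `s` may exceed the room `T`. Cut the segment from `x` to `y` into `N`
  -- pieces and use `t = s / N` on each. The gradient differences telescope, and `N` times the sum
  -- is exactly the claim for `s`.
  obtain ⟨N, hN⟩ := exists_nat_gt (|s| / T)
  have hN0 : (0 : ℝ) < N := lt_of_le_of_lt (by positivity) hN
  have hsN : |s / N| ≤ T := by
    rw [abs_div, abs_of_pos hN0, div_le_iff₀ hN0]
    rw [div_lt_iff₀ hT] at hN
    linarith
  set t := s / N with ht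
  let z : ℕ → E := fun i => x + ((i : ℝ) / N) • (y - x)
  have hz : ∀ i ≤ N, ∀ t, |t| ≤ T → z i + t • w ∈ U := by
    intro i hi t ht
    have hi' : (i : ℝ) / N ≤ 1 := by
      rw [div_le_one hN0]; exact_mod_cast hi
    have := hU (hx t ht) (hy t ht) (a := 1 - (i : ℝ) / N) (b := (i : ℝ) / N)
      (by linarith) (by positivity) (by ring)
    convert this using 1
    simp only [z]
    module
  have step : ∀ i ∈ Finset.range N, 0 ≤ (G (z (i + 1)) - G (z i)) ((1 / (N : ℝ)) • (y - x))
      + 2 * t * (G (z (i + 1)) - G (z i)) w + L * t ^ 2 * B w w := by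
    intro i hi
    have hi := Finset.mem_range.1 hi
    have e : z (i + 1) - z i = (1 / (N : ℝ)) • (y - x) := by
      simp only [z, Nat.cast_add, Nat.cast_one]
      module
    have m1 : ∀ i ≤ N, z i ∈ U := fun i hi => by simpa using hz i hi 0 (by simpa using hT.le)
    have := h.grad_sub_two_points (p := z i) (q := z (i + 1)) (w := w) (t := t)
      (m1 _ (by omega)) (m1 _ (by omega)) (hz _ (by omega) _ hsN)
      (by
        have := hz i (by omega) (-t) (by simpa using hsN)
        simpa [sub_eq_add_neg] using this)
    rwa [e] at this
  have tel : ∀ v, ∑ i ∈ Finset.range N, (G (z (i + 1)) - G (z i)) v = (G y - G x) v := by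
    intro v
    have h0 : z 0 = x := by simp [z]
    have hNN : z N = y := by simp [z, hN0.ne']
    have := Finset.sum_range_sub (fun i => G (z i) v) N
    simpa [h0, hNN] using this
  have hs := Finset.sum_nonneg step
  rw [Finset.sum_add_distrib, Finset.sum_add_distrib, tel, ← Finset.mul_sum, tel] at hs
  simp only [Finset.sum_const, Finset.card_range, nsmul_eq_mul, map_smul, smul_eq_mul] at hs
  have := mul_nonneg hN0.le hs
  have e : (N : ℝ) * (1 / N * (G y - G x) (y - x) + 2 * t * (G y - G x) w + N * (L * t ^ 2 * B w w))
      = (G y - G x) (y - x) + 2 * s * (G y - G x) w + L * s ^ 2 * B w w := by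
    rw [ht]; field_simp
  linarith

/-- Cocoercivity of the gradient, tested in directions of `U - U`; no interior is needed. -/
theorem cocoercive (h : ConvexSmoothOn B U φ G L) (hU : Convex ℝ U) {x y u v : E} (hx : x ∈ U)
    (hy : y ∈ U) (hu : u ∈ U) (hv : v ∈ U) (s : ℝ) :
    0 ≤ (G y - G x) (y - x) + 2 * s * (G y - G x) (u - v) + L * s ^ 2 * B (u - v) (u - v) := by
  -- Moving `x` and `y` by a fraction `δ` towards this centroid creates room `δ / 4` in the
  -- directions `u - v` and `y - x`. The inequality with room applies there, and `δ → 0` is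
  -- justified by continuity of `G` in those two directions.
  set c : E := (1 / 4 : ℝ) • (x + y + u + v) with hc
  let m : E → ℝ → E := fun p δ => p + δ • (c - p)
  have room_uv : ∀ p, p = x ∨ p = y → ∀ δ, 0 < δ → δ ≤ 1 → ∀ t, |t| ≤ δ / 4 →
      m p δ + t • (u - v) ∈ U := by
    intro p hp δ h0 h1 t ht
    obtain ⟨h2, h3⟩ := abs_le.1 ht
    rcases hp with rfl | rfl
    · convert combo_four_mem hU hx hy hu hv (a := 1 - δ + δ / 4) (b := δ / 4) (c := δ / 4 + t)
        (d := δ / 4 - t) (by linarith) (by linarith) (by linarith) (by linarith) (by ring) using 1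
      simp only [m, hc]; module
    · convert combo_four_mem hU hx hy hu hv (b := 1 - δ + δ / 4) (a := δ / 4) (c := δ / 4 + t)
        (d := δ / 4 - t) (by linarith) (by linarith) (by linarith) (by linarith) (by ring) using 1
      simp only [m, hc]; module
  have room_xy : ∀ p, p = x ∨ p = y → ∀ δ, 0 < δ → δ ≤ 1 → ∀ t, |t| ≤ δ / 4 →
      m p δ + t • (y - x) ∈ U := by
    intro p hp δ h0 h1 t ht
    obtain ⟨h2, h3⟩ := abs_le.1 ht
    rcases hp with rfl | rfl
    · convert combo_four_mem hU hx hy hu hv (a := 1 - δ + δ / 4 - t) (b := δ / 4 + t) (c := δ / 4)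
        (d := δ / 4) (by linarith) (by linarith) (by linarith) (by linarith) (by ring) using 1
      simp only [m, hc]; module
    · convert combo_four_mem hU hx hy hu hv (b := 1 - δ + δ / 4 + t) (a := δ / 4 - t) (c := δ / 4)
        (d := δ / 4) (by linarith) (by linarith) (by linarith) (by linarith) (by ring) using 1
      simp only [m, hc]; module
  have lim : ∀ p, p = x ∨ p = y → ∀ w, (∀ δ, 0 < δ → δ ≤ 1 → ∀ t, |t| ≤ δ / 4 →
      m p δ + t • w ∈ U) →
      Filter.Tendsto (fun δ => G (m p δ) w) (nhdsWithin 0 (Ioi 0)) (nhds (G p w)) := by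
    intro p hp w hw
    have hpU : p ∈ U := by rcases hp with rfl | rfl <;> assumption
    -- The bound of `grad_sub_le` with `t = ±δ/4` and `q - p = δ (c - p)`, divided by `δ/4`, is `K
    -- δ`.
    set K := 2 * L * B (c - p) (c - p) + L / 8 * B w w with hK
    rw [tendsto_iff_norm_sub_tendsto_zero]
    have hlin : Filter.Tendsto (fun δ : ℝ => K * δ) (nhdsWithin 0 (Ioi 0)) (nhds 0) := by
      have : Filter.Tendsto (fun δ : ℝ => K * δ) (nhds 0) (nhds (K * 0)) :=
        (continuous_const.mul continuous_id).tendsto 0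
      rw [mul_zero] at this
      exact this.mono_left nhdsWithin_le_nhds
    refine squeeze_zero' (Filter.Eventually.of_forall fun _ => norm_nonneg _) ?_ hlin
    filter_upwards [Ioc_mem_nhdsGT (zero_lt_one (α := ℝ))] with δ hδ
    obtain ⟨h0, h1⟩ := hδ
    have hq : m p δ ∈ U := by simpa using hw δ h0 h1 0 (by simp; linarith)
    have a1 := h.grad_sub_le (t := δ / 4) hpU hq (hw δ h0 h1 _ (abs_of_pos (by linarith)).le)
    have a2 := h.grad_sub_le (t := -(δ / 4)) hpU hq
      (hw δ h0 h1 _ (by rw [abs_neg]; exact (abs_of_pos (by linarith)).le))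
    have e : m p δ - p = δ • (c - p) := by simp only [m]; abel
    rw [e] at a1 a2
    simp only [map_smul, smul_eq_mul, smul_apply,
      sub_apply] at a1 a2
    rw [Real.norm_eq_abs, abs_le]
    constructor
    · refine le_of_mul_le_mul_left ?_ (by linarith : 0 < δ / 4)
      rw [hK]; nlinarith
    · refine le_of_mul_le_mul_left ?_ (by linarith : 0 < δ / 4)
      rw [hK]; nlinarith
  have key : ∀ᶠ δ in nhdsWithin (0 : ℝ) (Ioi 0), 0 ≤ (1 - δ) * (G (m y δ) (y - x) - G (m x δ) (y - x))
      + 2 * s * (G (m y δ) (u - v) - G (m x δ) (u - v)) + L * s ^ 2 * B (u - v) (u - v) := by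
    filter_upwards [Ioc_mem_nhdsGT (zero_lt_one (α := ℝ))] with δ hδ
    obtain ⟨h0, h1⟩ := hδ
    have := h.cocoercive_of_room hU (by linarith : 0 < δ / 4) (room_uv x (Or.inl rfl) δ h0 h1)
      (room_uv y (Or.inr rfl) δ h0 h1) s
    have e : m y δ - m x δ = (1 - δ) • (y - x) := by simp only [m]; module
    rw [e] at this
    simpa only [map_smul, smul_eq_mul, sub_apply] using this
  have ly := lim y (Or.inr rfl)
  have lx := lim x (Or.inl rfl)
  have l1 : Filter.Tendsto (fun δ : ℝ => 1 - δ) (nhdsWithin 0 (Ioi 0)) (nhds (1 - 0)) :=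
    ((continuous_const.sub continuous_id).tendsto 0).mono_left nhdsWithin_le_nhds
  have hl := ((l1.mul ((ly _ (room_xy y (Or.inr rfl))).sub (lx _ (room_xy x (Or.inl rfl))))).add
    (((ly _ (room_uv y (Or.inr rfl))).sub (lx _ (room_uv x (Or.inl rfl)))).const_mul
      (2 * s))).add_const (L * s ^ 2 * B (u - v) (u - v))
  have := ge_of_tendsto hl key
  simpa only [sub_zero, one_mul, sub_apply] using this

end ConvexSmoothOn

end Cocoercivity
end IPDS

namespace IPDS

/-! ### Convergence of the accelerated proximal gradient method -/

section APGAnalysis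

theorem isMinOn_argminOn {E : Type u} [Nonempty E] {U : Set E} {F : E → ℝ}
    (h : ∃ z ∈ U, IsMinOn F U z) : argminOn U F ∈ U ∧ IsMinOn F U (argminOn U F) :=
  Classical.epsilon_spec (p := fun z => z ∈ U ∧ IsMinOn F U z) h

variable {E : Type u} [NormedAddCommGroup E] [NormedSpace ℝ E]

/-- Strong convexity of `F` on `U` with respect to a quadratic form `q`, with parameter `m`. -/
def QuadConvexOn (q : E → ℝ) (U : Set E) (m : ℝ) (F : E → ℝ) : Prop :=
  ∀ u ∈ U, ∀ v ∈ U, ∀ a b : ℝ, 0 ≤ a → 0 ≤ b → a + b = 1 →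
    F (a • u + b • v) ≤ a * F u + b * F v - a * b * (m / 2 * q (u - v))

/-- Compare the minimizer `v` with `a u + (1 - a) v`, divide by `a`, and let `a → 0`. This replaces
all subgradient arguments for the nonsmooth terms. -/
theorem QuadConvexOn.add_le_of_isMinOn {q : E → ℝ} {U : Set E} {m : ℝ} {F : E → ℝ}
    (h : QuadConvexOn q U m F) (hU : Convex ℝ U) {u v : E} (hu : u ∈ U) (hv : v ∈ U)
    (hmin : IsMinOn F U v) : F v + m / 2 * q (u - v) ≤ F u := by
  have key : ∀ᶠ a in nhdsWithin (0 : ℝ) (Ioi 0),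
      0 ≤ F u - F v - (1 - a) * (m / 2 * q (u - v)) := by
    filter_upwards [Ioc_mem_nhdsGT (zero_lt_one (α := ℝ))] with a ha
    have h1 := h u hu v hv a (1 - a) ha.1.le (by linarith [ha.2]) (by ring)
    have h2 : F v ≤ _ := hmin (hU hu hv ha.1.le (by linarith [ha.2] : 0 ≤ 1 - a) (by ring))
    refine le_of_mul_le_mul_left ?_ ha.1
    nlinarith
  have l1 : Filter.Tendsto (fun a : ℝ => F u - F v - (1 - a) * (m / 2 * q (u - v)))
      (nhdsWithin 0 (Ioi 0)) (nhds (F u - F v - (1 - 0) * (m / 2 * q (u - v)))) := by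
    refine Filter.Tendsto.mono_left ?_ nhdsWithin_le_nhds
    exact Continuous.tendsto (by fun_prop) _
  have := ge_of_tendsto l1 key
  linarith

variable {B : E →L[ℝ] E →L[ℝ] ℝ}

theorem quad_combo (hB : ∀ u w, B u w = B w u) (u v : E) {a b : ℝ} (h : a + b = 1) :
    B (a • u + b • v) (a • u + b • v) = a * B u u + b * B v v - a * b * B (u - v) (u - v) := by
  obtain rfl : b = 1 - a := by linarith
  simp only [map_add, map_sub, map_smul, add_apply, smul_apply, sub_apply, smul_eq_mul]
  rw [hB v u]; ring

theorem quadConvexOn_quad (hB : ∀ u w, B u w = B w u) (U : Set E) (p : E) (m : ℝ) :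
    QuadConvexOn (fun u => B u u) U m (fun u => m / 2 * B (u - p) (u - p)) := by
  intro u _ v _ a b _ _ hab
  have e : a • u + b • v - p = a • (u - p) + b • (v - p) := by
    obtain rfl : b = 1 - a := by linarith
    module
  have := quad_combo hB (u - p) (v - p) hab
  rw [show u - p - (v - p) = u - v by abel] at this
  simp only
  rw [e, this]
  apply le_of_eq; ring

theorem quadConvexOn_linear (q : E → ℝ) (U : Set E) (s : E →L[ℝ] ℝ) :
    QuadConvexOn q U 0 (fun u => s u) := by
  intro u _ v _ a b _ _ _
  simp

theorem QuadConvexOn.add {q : E → ℝ} {U : Set E} {m m' : ℝ} {F F' : E → ℝ}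
    (h : QuadConvexOn q U m F) (h' : QuadConvexOn q U m' F') :
    QuadConvexOn q U (m + m') (fun u => F u + F' u) := by
  intro u hu v hv a b ha hb hab
  have h1 := h u hu v hv a b ha hb hab
  have h2 := h' u hu v hv a b ha hb hab
  simp only
  linear_combination h1 + h2

theorem QuadConvexOn.const_mul {q : E → ℝ} {U : Set E} {m : ℝ} {F : E → ℝ}
    (h : QuadConvexOn q U m F) {c : ℝ} (hc : 0 ≤ c) :
    QuadConvexOn q U (c * m) (fun u => c * F u) := by
  intro u hu v hv a b ha hb hab
  have h1 := mul_le_mul_of_nonneg_left (h u hu v hv a b ha hb hab) hc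
  simp only
  linear_combination h1

theorem apgCoeff_spec {L μ A : ℝ} (hL : 0 < L) (hμ : 0 ≤ μ) (hA : 0 ≤ A) :
    0 < apgCoeff L μ A ∧
      L * apgCoeff L μ A ^ 2 = 2 * (1 + μ * A) * (A + apgCoeff L μ A) := by
  set c := 2 * (1 + μ * A) / L with hc
  have hc0 : 0 < c := by positivity
  have hs := Real.sq_sqrt (by positivity : 0 ≤ c ^ 2 + 4 * c * A)
  have h0 := Real.sqrt_nonneg (c ^ 2 + 4 * c * A)
  have e : apgCoeff L μ A = (c + √(c ^ 2 + 4 * c * A)) / 2 := rfl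
  rw [e]
  refine ⟨by positivity, ?_⟩
  have hcL : 2 * (1 + μ * A) = L * c := by rw [hc]; field_simp
  rw [hcL]
  set r := √(c ^ 2 + 4 * c * A)
  linear_combination L * hs / 4

/-- With `s = √(μ/(2L))` the equation for `a` implies `a² ≥ 4 s² A (A + a)`. Its solutions satisfy
`a ≥ (2s + s²) A`, which is the claim. -/
theorem apgCoeff_growth {L μ A : ℝ} (hL : 0 < L) (hμ : 0 ≤ μ) (hA : 0 ≤ A) :
    A * (1 + √(μ / (2 * L))) ^ 2 ≤ A + apgCoeff L μ A := by
  obtain ⟨ha, hq⟩ := apgCoeff_spec hL hμ hA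
  set a := apgCoeff L μ A
  set s := √(μ / (2 * L)) with hs
  have hs0 : 0 ≤ s := Real.sqrt_nonneg _
  have hs2 : s ^ 2 = μ / (2 * L) := Real.sq_sqrt (by positivity)
  have hμs : μ = 2 * L * s ^ 2 := by rw [hs2]; field_simp
  by_contra! hcon
  have h1 : a < (2 * s + s ^ 2) * A := by linarith
  have h2 : 4 * s ^ 2 * A * (A + a) ≤ a ^ 2 := by
    refine le_of_mul_le_mul_left ?_ hL
    rw [hq, hμs]
    nlinarith [mul_nonneg hA ha.le]
  have hsA : 0 < s * A := by
    rcases hs0.eq_or_lt with h | h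
    · rw [← h] at h1; linarith
    · rcases hA.eq_or_lt with h' | h'
      · rw [← h'] at h1; linarith
      · positivity
  have h3 : 4 * s ^ 2 * A ≤ a := by
    by_contra! h3
    nlinarith [mul_pos ha (sub_pos.2 h3), mul_nonneg hA hA, sq_nonneg (s * A)]
  have h4 : a * (a - 4 * s ^ 2 * A) ≤ (2 * s + s ^ 2) * A * ((2 * s + s ^ 2) * A - 4 * s ^ 2 * A) :=
    mul_le_mul h1.le (by linarith) (by linarith) (by positivity)
  have h5 : 0 < s * (s * A) ^ 2 := by
    have : 0 < s := by
      rcases hs0.eq_or_lt with h | h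
      · rw [← h] at hsA; simp at hsA
      · exact h
    positivity
  nlinarith [sq_nonneg (s ^ 2 * A)]

/-- The conditions under which the accelerated method is analysed. -/
structure APGInput.Regular (I : APGInput E) (φ₁ : E → ℝ) : Prop where
  symm : ∀ u w, I.B u w = I.B w u
  nonneg : ∀ u, 0 ≤ I.B u u
  convex : Convex ℝ I.U
  compact : IsCompact I.U
  start_mem : I.u₀ ∈ I.U
  smooth : ConvexSmoothOn I.B I.U φ₁ (fun u => (I.grad u).val) I.L
  lsc : LowerSemicontinuousOn I.φ₂ I.U
  strong : QuadConvexOn (fun u => I.B u u) I.U I.μ I.φ₂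
  L_nonneg : 0 ≤ I.L
  μ_nonneg : 0 ≤ I.μ

namespace APGInput.Regular

variable {I : APGInput E} {φ₁ : E → ℝ}

theorem exists_min (h : I.Regular φ₁) {F : E → ℝ} (hF : ContinuousOn F I.U) {A : ℝ} (hA : 0 ≤ A) :
    ∃ z ∈ I.U, IsMinOn (fun u => F u + A * I.φ₂ u) I.U z := by
  refine LowerSemicontinuousOn.exists_isMinOn ⟨_, h.start_mem⟩ h.compact
    (hF.lowerSemicontinuousOn.add ?_)
  have hc : Continuous fun t : ℝ => A * t := by fun_prop
  intro x hx
  exact hc.continuousAt.comp_lowerSemicontinuousWithinAt (h.lsc x hx)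
    (fun a b hab => mul_le_mul_of_nonneg_left hab hA)

/-- The point `v = argmin ψ_k`. -/
noncomputable def _root_.IPDS.apgV (I : APGInput E) (st : APGState E) : E :=
  argminOn I.U (fun u => 1 / 2 * I.B (u - I.u₀) (u - I.u₀) + st.s u + st.A * I.φ₂ u)

/-- The extrapolated point `y`. -/
noncomputable def _root_.IPDS.apgY (I : APGInput E) (st : APGState E) : E :=
  st.x + (apgCoeff I.L I.μ st.A / (st.A + apgCoeff I.L I.μ st.A)) • (apgV I st - st.x)

theorem _root_.IPDS.apgStep_val (I : APGInput E) (st : APGState E) :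
    (apgStep I st).val =
      ⟨st.A + apgCoeff I.L I.μ st.A,
        argminOn I.U (fun u => (I.grad (apgY I st)).val u
          + I.L / 2 * I.B (u - apgY I st) (u - apgY I st) + I.φ₂ u),
        st.s + apgCoeff I.L I.μ st.A • (I.grad (argminOn I.U (fun u => (I.grad (apgY I st)).val u
          + I.L / 2 * I.B (u - apgY I st) (u - apgY I st) + I.φ₂ u))).val⟩ := rfl

theorem apgV_spec (h : I.Regular φ₁) (st : APGState E) (hA : 0 ≤ st.A) :
    apgV I st ∈ I.U ∧ ∀ u ∈ I.U,
      (1 / 2 * I.B (apgV I st - I.u₀) (apgV I st - I.u₀) + st.s (apgV I st)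
        + st.A * I.φ₂ (apgV I st)) + (1 + I.μ * st.A) / 2 * I.B (u - apgV I st) (u - apgV I st)
      ≤ 1 / 2 * I.B (u - I.u₀) (u - I.u₀) + st.s u + st.A * I.φ₂ u := by
  obtain ⟨h1, h2⟩ := isMinOn_argminOn (h.exists_min
    (F := fun u => 1 / 2 * I.B (u - I.u₀) (u - I.u₀) + st.s u) (by fun_prop) hA)
  refine ⟨h1, fun u hu => ?_⟩
  have hc := ((quadConvexOn_quad h.symm I.U I.u₀ 1).add
    (quadConvexOn_linear _ I.U st.s)).add (h.strong.const_mul hA)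
  have := hc.add_le_of_isMinOn h.convex hu h1 h2
  unfold apgV
  linarith

/-- The optimality condition of the proximal step as a variational inequality. The growth `(L/2)|u -
x|²` at the minimizer cancels the same term in the expansion of `|u - y|²` about `x`. -/
theorem prox_spec (h : I.Regular φ₁) (y : E) (g : E →L[ℝ] ℝ) {x : E}
    (hx : x = argminOn I.U (fun u => g u + I.L / 2 * I.B (u - y) (u - y) + I.φ₂ u)) :
    x ∈ I.U ∧ ∀ u ∈ I.U, I.φ₂ x ≤ I.φ₂ u + g (u - x) + I.L * I.B (x - y) (u - x) := by
  have hex := h.exists_min (F := fun u => g u + I.L / 2 * I.B (u - y) (u - y)) (by fun_prop)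
    zero_le_one
  simp only [one_mul] at hex
  obtain ⟨h1, h2⟩ := isMinOn_argminOn hex
  rw [← hx] at h1 h2
  refine ⟨h1, fun u hu => ?_⟩
  have hc := ((quadConvexOn_linear (fun u => I.B u u) I.U g).add
    (quadConvexOn_quad h.symm I.U y I.L)).add h.strong
  have := hc.add_le_of_isMinOn h.convex hu h1 h2
  have e : u - y = (u - x) + (x - y) := by abel
  rw [e] at this
  simp only [map_add, add_apply] at this
  have hg : g (u - x) = g u - g x := by simp
  have hs := h.symm (x - y) (u - x)
  have hn := mul_nonneg h.μ_nonneg (h.nonneg (u - x))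
  rw [← hs] at this
  linarith

/-- The invariant of the method: `A φ(x) ≤ min ψ` and `ψ(u) ≤ ½|u - u₀|² + A φ(u)`. -/
def _root_.IPDS.APGInvariant (I : APGInput E) (φ₁ : E → ℝ) (st : APGState E) : Prop :=
  st.x ∈ I.U ∧ 0 ≤ st.A ∧ ∃ c : ℝ,
    (∀ u ∈ I.U, st.A * (φ₁ st.x + I.φ₂ st.x)
      ≤ 1 / 2 * I.B (u - I.u₀) (u - I.u₀) + st.s u + st.A * I.φ₂ u + c) ∧
    (∀ u ∈ I.U, st.s u + c ≤ st.A * φ₁ u)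

/-- The invariant at `v` and the growth of `ψ` around `v` are added to `a` times the prox inequality
at `u`, and `A` times that inequality and convexity of `φ₁` at the old iterate. Since `(A + a) y = A
x + a v`, what remains involves only `d = y - x'` and `w = u - v`, and is closed by cocoercivity in
the direction `d + α w`. -/
theorem invariant_step (h : I.Regular φ₁) (hL : 0 < I.L) {st : APGState E}
    (hst : APGInvariant I φ₁ st) : APGInvariant I φ₁ (apgStep I st).val := by
  obtain ⟨hx, hA, c, hc1, hc2⟩ := hst
  obtain ⟨ha, hq⟩ := apgCoeff_spec hL h.μ_nonneg hA
  obtain ⟨hv, hv2⟩ := h.apgV_spec st hA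
  rw [apgStep_val]
  set x' := argminOn I.U (fun u => (I.grad (apgY I st)).val u
    + I.L / 2 * I.B (u - apgY I st) (u - apgY I st) + I.φ₂ u) with hx'
  obtain ⟨hx'U, hopt⟩ := h.prox_spec _ _ hx'
  have hy : apgY I st = st.x + (apgCoeff I.L I.μ st.A / (st.A + apgCoeff I.L I.μ st.A)) •
    (apgV I st - st.x) := rfl
  set y := apgY I st
  set a := apgCoeff I.L I.μ st.A
  set v := apgV I st
  set A := st.A
  set L := I.L
  set B := I.B
  set G : E → E →L[ℝ] ℝ := fun u => (I.grad u).val with hG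
  have hA' : 0 < A + a := by positivity
  have hyU : y ∈ I.U := by
    rw [hy]
    have := h.convex hx hv (a := 1 - a / (A + a)) (b := a / (A + a))
      (by rw [sub_nonneg, div_le_one hA']; linarith) (by positivity) (by ring)
    convert this using 1
    module
  have hAy : (A + a) • y = A • st.x + a • v := by
    rw [hy, smul_add, smul_smul, mul_div_cancel₀ _ hA'.ne']
    module
  refine ⟨hx'U, hA'.le, c + a * (φ₁ x' - G x' x'), fun u hu => ?_, fun u hu => ?_⟩
  · -- the direction `e = (y - x') + (a / (2 (A + a))) (u - v)`
    set α := a / (2 * (A + a)) with hα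
    have hα0 : 0 < α := by positivity
    have haα : a = 2 * (A + a) * α := by rw [hα]; field_simp
    -- Dividing by `1 + α` makes `d + α w` a difference of two points of `U`; the choice `s = -(1 +
    -- α)` below undoes the scaling.
    have mem : ∀ p ∈ I.U, ∀ q ∈ I.U, (1 / (1 + α)) • p + (α / (1 + α)) • q ∈ I.U :=
      fun p hp q hq => h.convex hp hq (by positivity) (by positivity) (by field_simp)
    have hco := h.smooth.cocoercive h.convex hx'U hyU (mem y hyU u hu) (mem x' hx'U v hv)
      (-(1 + α))
    have hsm := h.smooth.lower _ hx x' hx'U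
    have e : (1 / (1 + α)) • y + (α / (1 + α)) • u - ((1 / (1 + α)) • x' + (α / (1 + α)) • v)
        = (1 / (1 + α)) • ((y - x') + α • (u - v)) := by module
    rw [e] at hco
    have h1 := hopt u hu
    have h2 := hopt _ hx
    have h3 := hv2 u hu
    have h4 := hc1 v hv
    set w := u - v with hw
    set d := y - x' with hd
    have exd : x' - y = -d := by rw [hd]; abel
    have e5 : A • (st.x - x') + a • (u - x') = (A + a) • d + a • w := by
      have : (A + a) • d + a • w = ((A + a) • y) - (A + a) • x' + a • w := by rw [hd, smul_sub]
      rw [this, hAy, hw]; module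
    have hlin : ∀ f : E →L[ℝ] ℝ, A * f (st.x - x') + a * f (u - x') = (A + a) * f d + a * f w := by
      intro f
      have := congrArg f e5
      simpa using this
    have l1 := hlin (G y)
    have l2 := hlin (G x')
    have l3 := hlin (B d)
    rw [exd] at h1 h2
    change φ₁ x' + G x' (st.x - x') ≤ φ₁ st.x at hsm
    change I.φ₂ x' ≤ I.φ₂ u + G y (u - x') + L * B (-d) (u - x') at h1
    change I.φ₂ x' ≤ I.φ₂ st.x + G y (st.x - x') + L * B (-d) (st.x - x') at h2
    change 0 ≤ (G y - G x') d + 2 * -(1 + α) * (G y - G x') ((1 / (1 + α)) • (d + α • w))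
      + L * (-(1 + α)) ^ 2 * B ((1 / (1 + α)) • (d + α • w)) ((1 / (1 + α)) • (d + α • w)) at hco
    have hco' : 0 ≤ (G y d - G x' d) - 2 * ((G y d - G x' d) + α * (G y w - G x' w))
        + L * (B d d + 2 * α * B d w + α ^ 2 * B w w) := by
      have hs := h.symm w d
      change B w d = B d w at hs
      have hne : 1 + α ≠ 0 := by positivity
      simp only [map_add, map_smul, smul_eq_mul, add_apply, smul_apply, sub_apply] at hco
      rw [hs] at hco
      convert hco using 1
      field_simp
      ring
    have hco2 := mul_nonneg hA'.le hco'
    simp only [map_neg, neg_apply] at h1 h2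
    have m1 := mul_le_mul_of_nonneg_left h1 ha.le
    have m2 := mul_le_mul_of_nonneg_left h2 hA
    have m3 := mul_le_mul_of_nonneg_left hsm hA
    -- This is the defining equation of `a`: the growth of `ψ` at `v` exactly matches the `|α w|²`
    -- term of cocoercivity.
    have hq' : (1 + I.μ * A) / 2 * B w w = (A + a) * L * α ^ 2 * B w w := by
      have : (1 + I.μ * A) / 2 = (A + a) * L * α ^ 2 := by
        rw [hα]; field_simp; linear_combination -hq
      rw [this]
    have eg : (st.s + a • G x') u = st.s u + a * G x' u := by simp
    have eux : G x' (u - x') = G x' u - G x' x' := by simp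
    rw [eg]
    have p1 : a * G y w = 2 * (A + a) * α * G y w := by rw [← haα]
    have p2 : a * G x' w = 2 * (A + a) * α * G x' w := by rw [← haα]
    have p3 : a * B d w = 2 * (A + a) * α * B d w := by rw [← haα]
    rw [hq'] at h3
    linear_combination m1 + m2 + m3 + h3 + h4 + hco2 + a * eux + l1 + p1 - p2 - L * (l3 + p3) - l2
  · have := mul_le_mul_of_nonneg_left (h.smooth.lower u hu x' hx'U) ha.le
    have h2 := hc2 u hu
    have eux : G x' (u - x') = G x' u - G x' x' := by simp
    have eg : (st.s + a • G x') u = st.s u + a * G x' u := by simp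
    change a * (φ₁ x' + G x' (u - x')) ≤ _ at this
    change (st.s + a • G x') u + (c + a * (φ₁ x' - G x' x')) ≤ (A + a) * φ₁ u
    rw [eg]; rw [eux] at this
    linarith

theorem _root_.IPDS.apgRun_succ_val (I : APGInput E) (N : ℕ) :
    (apgRun I (N + 1)).val = (apgStep I (apgRun I N).val).val := rfl

theorem invariant (h : I.Regular φ₁) (hL : 0 < I.L) (N : ℕ) :
    APGInvariant I φ₁ (apgRun I N).val := by
  induction N with
  | zero =>
    refine ⟨h.start_mem, le_rfl, 0, fun u _ => ?_, fun u _ => ?_⟩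
    · have := h.nonneg (u - I.u₀)
      change (0 : ℝ) * _ ≤ 1 / 2 * I.B (u - I.u₀) (u - I.u₀) + (0 : E →L[ℝ] ℝ) u + 0 * I.φ₂ u + 0
      simp only [zero_mul, zero_apply, add_zero]; linarith
    · change (0 : E →L[ℝ] ℝ) u + 0 ≤ 0 * φ₁ u
      simp
  | succ N ih => rw [apgRun_succ_val]; exact h.invariant_step hL ih

/-- The first coefficient is exactly `2 / L`, and each later step multiplies by at least the growth
factor; hence the exponent `2 (N - 1)` in the stopping rule. -/
theorem coeff_lower (h : I.Regular φ₁) (hL : 0 < I.L) (N : ℕ) :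
    2 / I.L * (1 + √(I.μ / (2 * I.L))) ^ (2 * N) ≤ (apgRun I (N + 1)).val.A := by
  induction N with
  | zero =>
    have : (apgRun I (0 + 1)).val.A = 0 + apgCoeff I.L I.μ 0 := rfl
    rw [this]
    have h2 : (0 : ℝ) ≤ 2 / I.L := by positivity
    simp [apgCoeff, Real.sqrt_sq h2]
  | succ N ih =>
    have hA := (h.invariant hL (N + 1)).2.1
    have := apgCoeff_growth hL h.μ_nonneg hA
    rw [apgRun_succ_val, apgStep_val]
    refine le_trans ?_ this
    rw [mul_add, pow_add, ← mul_assoc]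
    exact mul_le_mul_of_nonneg_right ih (by positivity)

theorem apgRun_gap (h : I.Regular φ₁) (hL : 0 < I.L) (N : ℕ) {u : E} (hu : u ∈ I.U) :
    (apgRun I N).val.A * ((φ₁ (apgRun I N).val.x + I.φ₂ (apgRun I N).val.x) - (φ₁ u + I.φ₂ u))
      ≤ 1 / 2 * I.B (u - I.u₀) (u - I.u₀) := by
  obtain ⟨-, -, c, h1, h2⟩ := h.invariant hL N
  have := h1 u hu
  have := h2 u hu
  linarith

theorem _root_.IPDS.exists_apgIterations {L μ D acc : ℝ} (hL : 0 < L) (hμ : 0 < μ)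
    (hacc : 0 < acc) :
    {N : ℕ | 1 ≤ N ∧ L / 4 * D ^ 2 ≤ acc * (1 + √(μ / (2 * L))) ^ (2 * (N - 1))}.Nonempty := by
  have hs : 0 < √(μ / (2 * L)) := Real.sqrt_pos.2 (by positivity)
  obtain ⟨n, hn⟩ := pow_unbounded_of_one_lt (L / 4 * D ^ 2 / acc)
    (by linarith : 1 < 1 + √(μ / (2 * L)))
  refine ⟨n + 1, by omega, ?_⟩
  rw [div_lt_iff₀ hacc, mul_comm _ acc] at hn
  refine hn.le.trans ?_
  refine mul_le_mul_of_nonneg_left ?_ hacc.le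
  exact pow_le_pow_right₀ (by linarith) (by omega)

theorem _root_.IPDS.apgIterations_zero {μ D acc : ℝ} (hacc : 0 ≤ acc) :
    apgIterations 0 μ D acc = 1 := by
  have : {N : ℕ | 1 ≤ N ∧ (0 : ℝ) / 4 * D ^ 2 ≤ acc * (1 + √(μ / (2 * 0))) ^ (2 * (N - 1))}
      = {N : ℕ | 1 ≤ N} := by
    ext N
    simp only [mem_ofPred_eq, and_iff_left_iff_imp]
    intro _
    simp [hacc]
  unfold apgIterations
  rw [this]
  exact le_antisymm (Nat.sInf_le (by simp)) (Nat.sInf_mem (s := {N : ℕ | 1 ≤ N}) ⟨1, by simp⟩)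

/-- The accelerated method, run for the prescribed number of iterations, reaches the accuracy. -/
theorem apgSolve_spec (h : I.Regular φ₁) (hμ : 0 < I.μ) {D acc : ℝ} (hacc : 0 < acc)
    (hD : ∀ u ∈ I.U, I.B (u - I.u₀) (u - I.u₀) ≤ D ^ 2) :
    (apgSolve I D acc).val ∈ I.U ∧ ∀ u ∈ I.U,
      φ₁ (apgSolve I D acc).val + I.φ₂ (apgSolve I D acc).val ≤ φ₁ u + I.φ₂ u + acc := by
  have hval : (apgSolve I D acc).val = (apgRun I (apgIterations I.L I.μ D acc)).val.x := rfl
  rw [hval]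
  rcases h.L_nonneg.eq_or_lt with hL | hL
  -- For `L = 0`, division by zero makes the coefficient `0`, hence `y = u₀`. Then `φ₁` equals its
  -- linearization at `u₀` on `U`, so the single proximal step is exact.
  · rw [← hL, apgIterations_zero hacc.le, apgRun_succ_val, apgStep_val]
    simp only
    set st := (apgRun I 0).val
    have hst : st.x = I.u₀ := rfl
    have hyx : apgY I st = I.u₀ := by
      have hA : st.A = 0 := rfl
      simp [apgY, hA, ← hL, apgCoeff, hst]
    rw [hyx]
    obtain ⟨hx, hopt⟩ := h.prox_spec I.u₀ (I.grad I.u₀).val rfl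
    refine ⟨hx, fun u hu => ?_⟩
    set x := argminOn I.U (fun u => (I.grad I.u₀).val u
        + I.L / 2 * I.B (u - I.u₀) (u - I.u₀) + I.φ₂ u)
    have h1 := h.smooth.lower u hu _ h.start_mem
    have h2 := h.smooth.upper x hx _ h.start_mem
    have h3 := hopt u hu
    simp only [← hL, zero_div, zero_mul, add_zero, map_sub] at h1 h2 h3
    linarith
  · obtain ⟨h1, h2⟩ := Nat.sInf_mem (exists_apgIterations (D := D) hL hμ hacc)
    change 1 ≤ apgIterations I.L I.μ D acc at h1
    change _ ≤ acc * _ ^ (2 * (apgIterations I.L I.μ D acc - 1)) at h2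
    obtain ⟨N, hN⟩ := Nat.exists_eq_add_of_le' h1
    rw [hN] at h2 ⊢
    simp only [Nat.add_sub_cancel] at h2
    refine ⟨(h.invariant hL _).1, fun u hu => ?_⟩
    have g := h.apgRun_gap hL (N + 1) hu
    have hlow := h.coeff_lower hL N
    set A := (apgRun I (N + 1)).val.A
    set x := (apgRun I (N + 1)).val.x
    have hA : 0 < A := lt_of_lt_of_le (by positivity) hlow
    have : 1 / 2 * D ^ 2 ≤ acc * A := by
      have := mul_le_mul_of_nonneg_left hlow hacc.le
      refine le_trans ?_ this
      have e : acc * (2 / I.L * (1 + √(I.μ / (2 * I.L))) ^ (2 * N))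
        = 2 / I.L * (acc * (1 + √(I.μ / (2 * I.L))) ^ (2 * N)) := by ring
      rw [e]
      have := mul_le_mul_of_nonneg_left h2 (by positivity : 0 ≤ 2 / I.L)
      refine le_trans (le_of_eq ?_) this
      field_simp; ring
    have : A * (φ₁ x + I.φ₂ x - (φ₁ u + I.φ₂ u)) ≤ A * acc := by linarith [hD u hu]
    have := le_of_mul_le_mul_left this hA
    linarith

end APGInput.Regular

theorem apgSolve_calls {I : APGInput E} {m : ℕ} (hm : ∀ u, (I.grad u).calls = m) (D acc : ℝ) :
    (apgSolve I D acc).calls = 2 * m * apgIterations I.L I.μ D acc := by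
  have step : ∀ st, (apgStep I st).calls = 2 * m := by
    intro st
    have : (apgStep I st).calls = (I.grad (apgY I st)).calls
      + ((I.grad (apgStep I st).val.x).calls + 0) := rfl
    rw [this, hm, hm]; ring
  have run : ∀ N, (apgRun I N).calls = 2 * m * N := by
    intro N
    induction N with
    | zero => rfl
    | succ N ih =>
      have : (apgRun I (N + 1)).calls = (apgRun I N).calls
        + (apgStep I (apgRun I N).val).calls := rfl
      rw [this, ih, step]; ring
  have : (apgSolve I D acc).calls = (apgRun I (apgIterations I.L I.μ D acc)).calls + 0 := rfl
  rw [this, run, add_zero]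

end APGAnalysis
end IPDS

namespace IPDS

/-! ### First-order inequalities and convexity of the problem data -/

section Calculus

variable {E : Type u} [NormedAddCommGroup E] [NormedSpace ℝ E]

theorem hasDerivAt_along {f : E → ℝ} (hf : Differentiable ℝ f) (y w : E) (t : ℝ) :
    HasDerivAt (fun s : ℝ => f (y + s • w)) (fderiv ℝ f (y + t • w) w) t := by
  have h1 : HasDerivAt (fun s : ℝ => y + s • w) w t := by
    simpa using ((hasDerivAt_id t).smul_const w).const_add y
  exact (hf (y + t • w)).hasFDerivAt.comp_hasDerivAt t h1

theorem add_fderiv_le_of_convexOn {f : E → ℝ} (hf : Differentiable ℝ f) (hc : ConvexOn ℝ univ f)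
    (x y : E) : f y + fderiv ℝ f y (x - y) ≤ f x := by
  have h1 := hasDerivAt_along hf y (x - y) 0
  have hc1 : ConvexOn ℝ univ (fun s : ℝ => f (y + s • (x - y))) := by
    have := hc.comp_affineMap (AffineMap.lineMap y x : ℝ →ᵃ[ℝ] E)
    rw [preimage_univ] at this
    have e : (fun s : ℝ => f (y + s • (x - y))) = f ∘ AffineMap.lineMap y x := by
      ext s
      simp [AffineMap.lineMap_apply, add_comm]
    rwa [e]
  have := hc1.le_slope_of_hasDerivAt (mem_univ 0) (mem_univ 1) zero_lt_one h1
  simp [slope_def_field] at this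
  simp only [map_sub]
  linarith

/-- Along the segment from `y` to `x`, `f` minus its linearization and minus the quadratic has
nonpositive derivative. Only the Lipschitz bound on `U` enters. -/
theorem le_quadratic_of_lipschitz {f : E → ℝ} (hf : Differentiable ℝ f) {U : Set E}
    (hU : Convex ℝ U) {L : ℝ}
    (hL : ∀ x ∈ U, ∀ y ∈ U, ‖fderiv ℝ f x - fderiv ℝ f y‖ ≤ L * ‖x - y‖) {x y : E} (hx : x ∈ U)
    (hy : y ∈ U) : f x ≤ f y + fderiv ℝ f y (x - y) + L / 2 * ‖x - y‖ ^ 2 := by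
  set w := x - y with hw
  have hd : ∀ t : ℝ, HasDerivAt (fun s : ℝ => f (y + s • w) - s * fderiv ℝ f y w
      - L / 2 * ‖w‖ ^ 2 * s ^ 2)
      (fderiv ℝ f (y + t • w) w - 1 * fderiv ℝ f y w - L / 2 * ‖w‖ ^ 2 * (2 * t)) t := by
    intro t
    refine ((hasDerivAt_along hf y w t).sub ((hasDerivAt_id t).mul_const _)).sub ?_
    simpa using (hasDerivAt_pow 2 t).const_mul (L / 2 * ‖w‖ ^ 2)
  have hanti := antitoneOn_of_deriv_nonpos (convex_Icc (0 : ℝ) 1)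
    (fun t _ => (hd t).continuousAt.continuousWithinAt)
    (fun t _ => (hd t).differentiableAt.differentiableWithinAt) (fun t ht => by
      rw [(hd t).deriv]
      rw [interior_Icc] at ht
      have hz : y + t • w ∈ U := by
        have := hU hy hx (a := 1 - t) (b := t) (by linarith [ht.2]) ht.1.le (by ring)
        convert this using 1
        rw [hw]; module
      have h1 := hL _ hz _ hy
      rw [add_sub_cancel_left, norm_smul, Real.norm_eq_abs, abs_of_pos ht.1] at h1
      have h2 := le_trans (le_abs_self _) ((fderiv ℝ f (y + t • w) - fderiv ℝ f y).le_opNorm w)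
      have h3 := mul_le_mul_of_nonneg_right h1 (norm_nonneg w)
      rw [sub_apply] at h2
      nlinarith)
  have := hanti (left_mem_Icc.2 zero_le_one) (right_mem_Icc.2 zero_le_one) zero_le_one
  have e : y + w = x := by rw [hw]; abel
  simp [e] at this
  linarith

theorem QuadConvexOn.mono {q q' : E → ℝ} {U : Set E} {m m' : ℝ} {F : E → ℝ}
    (h : QuadConvexOn q U m F) (hq : ∀ u, m' * q' u ≤ m * q u) : QuadConvexOn q' U m' F := by
  intro u hu v hv a b ha hb hab
  have h1 := h u hu v hv a b ha hb hab
  have h2 := mul_le_mul_of_nonneg_left (hq (u - v)) (mul_nonneg ha hb)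
  linarith

theorem quadConvexOn_of_convexOn {U : Set E} {F : E → ℝ} (h : ConvexOn ℝ U F) (q : E → ℝ) :
    QuadConvexOn q U 0 F := by
  intro u hu v hv a b ha hb hab
  have := h.2 hu hv ha hb hab
  simpa using this

end Calculus

namespace SaddleProblem

variable {E₁ : Type u} [NormedAddCommGroup E₁] [NormedSpace ℝ E₁]
  {E₂ : Type v} [NormedAddCommGroup E₂] [NormedSpace ℝ E₂]

namespace Admissible

variable {P : SaddleProblem E₁ E₂} {c : Constants}

theorem X_compact [FiniteDimensional ℝ E₁] (hP : P.Admissible c) : IsCompact P.X :=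
  have : ProperSpace E₁ := FiniteDimensional.proper_real E₁
  Metric.isCompact_of_isClosed_isBounded hP.X_closed hP.X_bounded

theorem Λ_compact [FiniteDimensional ℝ E₂] (hP : P.Admissible c) : IsCompact P.Λ :=
  have : ProperSpace E₂ := FiniteDimensional.proper_real E₂
  Metric.isCompact_of_isClosed_isBounded hP.Λ_closed hP.Λ_bounded

theorem hasFDerivAt_left (hP : P.Admissible c) (x : E₁) (l : E₂) :
    HasFDerivAt (fun z => P.Φ z l) ((1 / (P.n : ℝ)) • ∑ i, fderiv ℝ (fun z => P.Φi i z l) x) x := by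
  have := (HasFDerivAt.fun_sum (u := Finset.univ) fun i _ =>
    (hP.Φi_differentiable_left i l x).hasFDerivAt).const_smul (1 / (P.n : ℝ))
  exact this

theorem hasFDerivAt_right (hP : P.Admissible c) (x : E₁) (l : E₂) :
    HasFDerivAt (fun z => P.Φ x z) ((1 / (P.n : ℝ)) • ∑ i, fderiv ℝ (fun z => P.Φi i x z) l) l := by
  have := (HasFDerivAt.fun_sum (u := Finset.univ) fun i _ =>
    (hP.Φi_differentiable_right i x l).hasFDerivAt).const_smul (1 / (P.n : ℝ))
  exact this

theorem differentiable_left (hP : P.Admissible c) (l : E₂) :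
    Differentiable ℝ (fun z => P.Φ z l) := fun x => (hP.hasFDerivAt_left x l).differentiableAt

theorem differentiable_right (hP : P.Admissible c) (x : E₁) :
    Differentiable ℝ (fun z => P.Φ x z) := fun l => (hP.hasFDerivAt_right x l).differentiableAt

theorem Φ_convex (hP : P.Admissible c) (l : E₂) : ConvexOn ℝ univ (fun x => P.Φ x l) := by
  refine ⟨convex_univ, fun x _ y _ a b ha hb hab => ?_⟩
  simp only [Φ, smul_eq_mul]
  have h := Finset.sum_le_sum fun i (_ : i ∈ Finset.univ) =>
    (hP.Φi_convex i l).2 (mem_univ x) (mem_univ y) ha hb hab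
  simp only [smul_eq_mul, Finset.sum_add_distrib, ← Finset.mul_sum] at h
  have := mul_le_mul_of_nonneg_left h (by positivity : 0 ≤ 1 / (P.n : ℝ))
  linarith

theorem Φ_concave (hP : P.Admissible c) (x : E₁) : ConvexOn ℝ univ (fun l => -P.Φ x l) := by
  refine ⟨convex_univ, fun l _ l' _ a b ha hb hab => ?_⟩
  simp only [Φ, smul_eq_mul]
  have h := Finset.sum_le_sum fun i (_ : i ∈ Finset.univ) =>
    (hP.Φi_concave i x).2 (mem_univ l) (mem_univ l') ha hb hab
  simp only [smul_eq_mul, Finset.sum_add_distrib, ← Finset.mul_sum] at h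
  have := mul_le_mul_of_nonneg_left h (by positivity : 0 ≤ 1 / (P.n : ℝ))
  linarith

theorem le_linearization_right (hP : P.Admissible c) (x : E₁) (l l' : E₂) :
    P.Φ x l ≤ P.Φ x l' + P.gradL x l' (l - l') := by
  have := add_fderiv_le_of_convexOn (hP.differentiable_right x).neg (hP.Φ_concave x) l l'
  change -P.Φ x l' + fderiv ℝ (fun z => -P.Φ x z) l' (l - l') ≤ -P.Φ x l at this
  rw [fderiv_fun_neg, neg_apply] at this
  change _ ≤ _ + fderiv ℝ (fun z => P.Φ x z) l' (l - l')
  linarith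

theorem linearization_right_le (hP : P.Admissible c) {x : E₁} (hx : x ∈ P.X) {l l' : E₂}
    (hl : l ∈ P.Λ) (hl' : l' ∈ P.Λ) :
    P.Φ x l' + P.gradL x l' (l - l') - c.Lll / 2 * ‖l - l'‖ ^ 2 ≤ P.Φ x l := by
  have := le_quadratic_of_lipschitz (f := fun z => -P.Φ x z) (hP.differentiable_right x).neg
    hP.Λ_convex (L := c.Lll) (fun l hl l' hl' => by
      rw [fderiv_fun_neg, fderiv_fun_neg, neg_sub_neg, norm_sub_rev]
      exact hP.smooth_ll x hx l hl l' hl') hl hl'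
  rw [fderiv_fun_neg, neg_apply] at this
  change _ + fderiv ℝ (fun z => P.Φ x z) l' (l - l') - _ ≤ _
  linarith

theorem f_quadConvexOn (hP : P.Admissible c) :
    QuadConvexOn (fun u => ‖u‖ ^ 2) P.X c.μ P.f := by
  intro u hu v hv a b ha hb hab
  have hz := hP.X_convex hu hv ha hb hab
  have h1 := hP.f_strongly_convex u hu _ hz
  have h2 := hP.f_strongly_convex v hv _ hz
  set z := a • u + b • v with hzdef
  have e1 : u - z = b • (u - v) := by
    obtain rfl : a = 1 - b := by linarith
    rw [hzdef]; module
  have e2 : v - z = -(a • (u - v)) := by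
    obtain rfl : a = 1 - b := by linarith
    rw [hzdef]; module
  rw [e1, norm_smul, map_smul, Real.norm_of_nonneg hb, smul_eq_mul] at h1
  rw [e2, norm_neg, norm_smul, map_neg, map_smul, Real.norm_of_nonneg ha, smul_eq_mul] at h2
  have m1 := mul_le_mul_of_nonneg_left h1 ha
  have m2 := mul_le_mul_of_nonneg_left h2 hb
  have e : a * b * (c.μ / 2 * ‖u - v‖ ^ 2) = a * (c.μ / 2 * (b * ‖u - v‖) ^ 2)
      + b * (c.μ / 2 * (a * ‖u - v‖) ^ 2) := by
    obtain rfl : a = 1 - b := by linarith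
    ring
  have e3 : a * P.f z + b * P.f z = P.f z := by rw [← add_mul, hab, one_mul]
  simp only
  rw [e]
  linarith

theorem ω_quadConvexOn (hP : P.Admissible c) :
    QuadConvexOn (fun u => ‖u‖ ^ 2) P.Λ 1 P.ω := by
  intro u hu v hv a b ha hb hab
  simpa using hP.ω_strongly_convex.2 hu hv ha hb hab

theorem f_continuousOn (hP : P.Admissible c) : ContinuousOn P.f P.X := by
  obtain ⟨X', -, h1, h2⟩ := hP.f_differentiable
  exact h2.continuousOn.mono h1

theorem dual_lsc (hP : P.Admissible c) (ρ : ℝ) :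
    LowerSemicontinuousOn (fun l => P.h l + ρ * P.ω l) P.Λ :=
  hP.h_closed.add (continuousOn_const.mul hP.ω_continuous).lowerSemicontinuousOn

end Admissible

end SaddleProblem

/-! ### The inner method solves the subproblems -/

section Subproblems

variable {E₁ : Type u} [NormedAddCommGroup E₁] [NormedSpace ℝ E₁]
  {E₂ : Type v} [NormedAddCommGroup E₂] [NormedSpace ℝ E₂]

theorem IsEuclidean.sub_le_diam {E : Type u} [NormedAddCommGroup E] [NormedSpace ℝ E]
    {B : E →L[ℝ] E →L[ℝ] ℝ} {θ : ℝ} (hB : IsEuclidean B θ) {U : Set E}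
    (hU : Bornology.IsBounded U) {u w : E} (hu : u ∈ U) (hw : w ∈ U) :
    B (u - w) (u - w) ≤ (θ * Metric.diam U) ^ 2 := by
  have h1 := Metric.dist_le_diam_of_mem hU hu hw
  rw [dist_eq_norm] at h1
  refine (hB.upper _).trans ?_
  rw [mul_pow]
  gcongr

theorem dualInput_grad_val {I : Input E₁ E₂} (hP : I.P.Admissible I.c) (ρ : ℝ) (start : E₂)
    (x : E₁) (l : E₂) : ((dualInput I ρ start x).grad l).val = -I.P.gradL x l := by
  change -((1 / (I.P.n : ℝ)) • ∑ i, fderiv ℝ (fun z => I.P.Φi i x z) l) = _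
  rw [SaddleProblem.gradL, (hP.hasFDerivAt_right x l).fderiv]

theorem dualInput_grad_calls (I : Input E₁ E₂) (ρ : ℝ) (start : E₂)
    (x : E₁) (l : E₂) : ((dualInput I ρ start x).grad l).calls = I.P.n := by
  change (∑ _i : Fin I.P.n, 1) + 0 = _
  simp

theorem primalInput_grad_val {I : Input E₁ E₂} (hP : I.P.Admissible I.c) (start : E₁)
    (l : E₂) (x : E₁) : ((primalInput I start l).grad x).val
      = fderiv ℝ I.P.f x + I.P.gradX x l - (I.c.μ / I.θ₁ ^ 2) • I.B₁ (x - start) := by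
  change fderiv ℝ I.P.f x + ((1 / (I.P.n : ℝ)) • ∑ i, fderiv ℝ (fun z => I.P.Φi i z l) x)
    - (I.c.μ / I.θ₁ ^ 2) • I.B₁ (x - start) = _
  rw [SaddleProblem.gradX, (hP.hasFDerivAt_left x l).fderiv]

theorem primalInput_grad_calls (I : Input E₁ E₂) (start : E₁)
    (l : E₂) (x : E₁) : ((primalInput I start l).grad x).calls = I.P.n + 1 := by
  change 1 + ((∑ _i : Fin I.P.n, 1) + 0) = _
  simp [add_comm]

/-- Smoothness passes to the Euclidean norm without loss because `‖u‖ ≤ |u|`; strong convexity loses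
`θ₂²` because `|u| ≤ θ₂ ‖u‖`. -/
theorem dualInput_regular [FiniteDimensional ℝ E₂] {I : Input E₁ E₂} (hI : I.Admissible)
    (hc : I.c.Valid) (hθ : 1 ≤ I.θ₂) {ρ : ℝ} (hρ : 0 < ρ) {start : E₂} (hs : start ∈ I.P.Λ)
    {x : E₁} (hx : x ∈ I.P.X) :
    (dualInput I ρ start x).Regular (fun l => -I.P.Φ x l) where
  symm := hI.euclidean₂.symm
  nonneg u := (sq_nonneg ‖u‖).trans (hI.euclidean₂.lower u)
  convex := hI.problem.Λ_convex
  compact := hI.problem.Λ_compact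
  start_mem := hs
  smooth := by
    refine ⟨fun l hl l' hl' => ?_, fun l hl l' hl' => ?_⟩ <;>
      simp only [dualInput_grad_val hI.problem, neg_apply]
    · linarith [hI.problem.le_linearization_right x l l']
    · have h1 := hI.problem.linearization_right_le hx hl hl'
      have h2 := mul_le_mul_of_nonneg_left (hI.euclidean₂.lower (l - l'))
        (half_pos (zero_lt_one (α := ℝ))).le
      have h3 := mul_le_mul_of_nonneg_left h2 hc.Lll_nonneg
      simp only [dualInput]
      linarith
  lsc := hI.problem.dual_lsc ρ
  strong := by
    have := (quadConvexOn_of_convexOn hI.problem.h_convex (fun u => ‖u‖ ^ 2)).add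
      (hI.problem.ω_quadConvexOn.const_mul hρ.le)
    refine this.mono fun u => ?_
    have := hI.euclidean₂.upper u
    have hθ' : 0 < I.θ₂ := by linarith
    simp only [dualInput]
    rw [zero_add, mul_one, div_mul_eq_mul_div, div_le_iff₀ (by positivity)]
    nlinarith
  L_nonneg := hc.Lll_nonneg
  μ_nonneg := by
    change 0 ≤ ρ / I.θ₂ ^ 2
    positivity

/-- Since `(μ/θ₁²)|u|² ≤ μ‖u‖²`, the smooth part stays convex after the quadratic is moved to the
other term, and subtracting a quadratic does not harm the upper bound. -/
theorem primalInput_regular [FiniteDimensional ℝ E₁] {I : Input E₁ E₂} (hI : I.Admissible)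
    (hc : I.c.Valid) (hθ : 1 ≤ I.θ₁) {start : E₁} (hs : start ∈ I.P.X)
    {l : E₂} (hl : l ∈ I.P.Λ) :
    (primalInput I start l).Regular (fun x => I.P.f x + I.P.Φ x l
      - I.c.μ / I.θ₁ ^ 2 / 2 * I.B₁ (x - start) (x - start)) where
  symm := hI.euclidean₁.symm
  nonneg u := (sq_nonneg ‖u‖).trans (hI.euclidean₁.lower u)
  convex := hI.problem.X_convex
  compact := hI.problem.X_compact
  start_mem := hs
  smooth := by
    have hθ' : 0 < I.θ₁ := by linarith
    have hm : 0 ≤ I.c.μ / I.θ₁ ^ 2 := div_nonneg hc.mu_pos.le (by positivity)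
    have quad : ∀ x y : E₁, I.B₁ (x - start) (x - start) = I.B₁ (y - start) (y - start)
        + 2 * I.B₁ (y - start) (x - y) + I.B₁ (x - y) (x - y) := by
      intro x y
      have e : x - start = (y - start) + (x - y) := by abel
      rw [e]
      simp only [map_add, add_apply]
      rw [hI.euclidean₁.symm (x - y) (y - start)]; ring
    have hmθ : ∀ u, I.c.μ / I.θ₁ ^ 2 * I.B₁ u u ≤ I.c.μ * ‖u‖ ^ 2 := by
      intro u
      rw [div_mul_eq_mul_div, div_le_iff₀ (by positivity)]
      have := mul_le_mul_of_nonneg_left (hI.euclidean₁.upper u) hc.mu_pos.le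
      linarith
    refine ⟨fun x hx y hy => ?_, fun x hx y hy => ?_⟩ <;>
      simp only [primalInput_grad_val hI.problem, sub_apply, add_apply, smul_apply,
        smul_eq_mul] <;> rw [quad x y]
    · have h1 := hI.problem.f_strongly_convex x hx y hy
      have h2 := add_fderiv_le_of_convexOn (hI.problem.differentiable_left l)
        (hI.problem.Φ_convex l) x y
      have h3 := hmθ (x - y)
      simp only [SaddleProblem.gradX]
      linarith
    · have h1 := hI.problem.f_smooth x hx y hy
      have h2 := le_quadratic_of_lipschitz (hI.problem.differentiable_left l) hI.problem.X_convex
        (L := I.c.Lxx) (fun x hx y hy => hI.problem.smooth_xx x hx y hy l hl) hx hy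
      have h3 := mul_le_mul_of_nonneg_left (hI.euclidean₁.lower (x - y))
        (by linarith [hc.mu_pos, hc.mu_le, hc.Lxx_nonneg] : 0 ≤ (I.c.L + I.c.Lxx) / 2)
      have h4 := mul_nonneg hm ((sq_nonneg _).trans (hI.euclidean₁.lower (x - y)))
      simp only [primalInput, SaddleProblem.gradX]
      linarith
  lsc := by
    refine hI.problem.g_closed.add (ContinuousOn.lowerSemicontinuousOn ?_)
    have : Continuous fun x => I.c.μ / I.θ₁ ^ 2 / 2 * I.B₁ (x - start) (x - start) := by fun_prop
    exact this.continuousOn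
  strong := by
    have := (quadConvexOn_of_convexOn hI.problem.g_convex (fun u => I.B₁ u u)).add
      (quadConvexOn_quad hI.euclidean₁.symm I.P.X start (I.c.μ / I.θ₁ ^ 2))
    rw [zero_add] at this
    exact this
  L_nonneg := by
    change 0 ≤ I.c.L + I.c.Lxx
    linarith [hc.mu_pos, hc.mu_le, hc.Lxx_nonneg]
  μ_nonneg := div_nonneg hc.mu_pos.le (sq_nonneg _)

theorem solveDual_spec [FiniteDimensional ℝ E₂] {I : Input E₁ E₂} (hI : I.Admissible)
    (hc : I.c.Valid) (hθ : 1 ≤ I.θ₂) {ρ η : ℝ} (hρ : 0 < ρ) (hη : 0 < η) {start : E₂}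
    (hs : start ∈ I.P.Λ) {x : E₁} (hx : x ∈ I.P.X) :
    I.P.IsInexactDual ρ η x (solveDual I ρ η start x).val := by
  have hθ' : 0 < I.θ₂ := by linarith
  obtain ⟨h1, h2⟩ := (dualInput_regular hI hc hθ hρ hs hx).apgSolve_spec
    (D := I.θ₂ * Metric.diam I.P.Λ) (acc := η)
    (by change 0 < ρ / I.θ₂ ^ 2; positivity) hη
    (fun u hu => hI.euclidean₂.sub_le_diam hI.problem.Λ_bounded hu hs)
  refine ⟨h1, ?_⟩
  rw [sub_le_iff_le_add, SaddleProblem.psiHatP]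
  refine csSup_le (hI.problem.Λ_nonempty.image _) ?_
  rintro _ ⟨l, hl, rfl⟩
  have := h2 l hl
  simp only [SaddleProblem.SD]
  change -I.P.Φ x (solveDual I ρ η start x).val + (I.P.h (solveDual I ρ η start x).val
    + ρ * I.P.ω (solveDual I ρ η start x).val) ≤ -I.P.Φ x l + (I.P.h l + ρ * I.P.ω l) + η at this
  linarith

theorem solvePrimal_spec [FiniteDimensional ℝ E₁] {I : Input E₁ E₂} (hI : I.Admissible)
    (hc : I.c.Valid) (hθ : 1 ≤ I.θ₁) {γ : ℝ} (hγ : 0 < γ) {start : E₁}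
    (hs : start ∈ I.P.X) {l : E₂} (hl : l ∈ I.P.Λ) :
    I.P.IsInexactPrimal γ l (solvePrimal I γ start l).val := by
  have hθ' : 0 < I.θ₁ := by linarith
  obtain ⟨h1, h2⟩ := (primalInput_regular hI hc hθ hs hl).apgSolve_spec
    (D := I.θ₁ * Metric.diam I.P.X) (acc := γ)
    (div_pos hc.mu_pos (by positivity)) hγ
    (fun u hu => hI.euclidean₁.sub_le_diam hI.problem.X_bounded hu hs)
  refine ⟨h1, ?_⟩
  rw [sub_le_comm, SaddleProblem.psiHatD]
  refine le_csInf (hI.problem.X_nonempty.image _) ?_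
  rintro _ ⟨x, hx, rfl⟩
  have := h2 x hx
  simp only [primalInput] at this
  simp only [SaddleProblem.SP, solvePrimal, primalInput]
  linarith

end Subproblems
end IPDS

/-! ### The smoothed duality gap and its contraction -/

namespace IPDS

variable {E₁ : Type u} [NormedAddCommGroup E₁] [NormedSpace ℝ E₁]
  {E₂ : Type v} [NormedAddCommGroup E₂] [NormedSpace ℝ E₂]

namespace SaddleProblem

/-- The duality gap in which the dual variable of the primal function is regularized by `ρ ω`. -/
noncomputable def smoothedGap {E₁ : Type u} {E₂ : Type v} (P : SaddleProblem E₁ E₂) (ρ : ℝ) (x : E₁) (l : E₂) :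
    ℝ :=
  P.f x + P.g x + P.psiHatP ρ x - (P.psiHatD l - P.h l)

namespace Admissible

variable {P : SaddleProblem E₁ E₂} {c : Constants}

theorem exists_argmax_SD [FiniteDimensional ℝ E₂] (hP : P.Admissible c) {ρ : ℝ} (hρ : 0 ≤ ρ)
    (x : E₁) : ∃ l ∈ P.Λ, P.psiHatP ρ x = P.SD ρ x l ∧
      ∀ l' ∈ P.Λ, P.SD ρ x l' + ρ / 2 * ‖l' - l‖ ^ 2 ≤ P.psiHatP ρ x := by
  have hcont : ContinuousOn (fun l => -P.Φ x l) P.Λ :=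
    (hP.differentiable_right x).neg.continuous.continuousOn
  obtain ⟨l, hl, hmin⟩ := LowerSemicontinuousOn.exists_isMinOn hP.Λ_nonempty hP.Λ_compact
    (hcont.lowerSemicontinuousOn.add (hP.dual_lsc ρ))
  have hq := (quadConvexOn_of_convexOn ((hP.Φ_concave x).subset (subset_univ _) hP.Λ_convex)
    (fun u => ‖u‖ ^ 2)).add ((quadConvexOn_of_convexOn hP.h_convex (fun u => ‖u‖ ^ 2)).add
      (hP.ω_quadConvexOn.const_mul hρ))
  have hstrong : ∀ l' ∈ P.Λ, P.SD ρ x l' + ρ / 2 * ‖l' - l‖ ^ 2 ≤ P.SD ρ x l := by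
    intro l' hl'
    have := hq.add_le_of_isMinOn hP.Λ_convex hl' hl hmin
    simp only [zero_add, mul_one] at this
    simp only [SD]
    linarith
  have heq : P.psiHatP ρ x = P.SD ρ x l := by
    refine IsGreatest.csSup_eq ⟨mem_image_of_mem _ hl, ?_⟩
    rintro _ ⟨l', hl', rfl⟩
    have := hstrong l' hl'
    have h2 : 0 ≤ ρ / 2 * ‖l' - l‖ ^ 2 := by positivity
    simp only
    linarith
  exact ⟨l, hl, heq, heq ▸ hstrong⟩

theorem SD_le_psiHatP [FiniteDimensional ℝ E₂] (hP : P.Admissible c) {ρ : ℝ} (hρ : 0 ≤ ρ)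
    (x : E₁) {l : E₂} (hl : l ∈ P.Λ) : P.SD ρ x l ≤ P.psiHatP ρ x := by
  obtain ⟨l', -, -, h⟩ := hP.exists_argmax_SD hρ x
  have := h l hl
  have h2 : 0 ≤ ρ / 2 * ‖l - l'‖ ^ 2 := by positivity
  linarith

theorem exists_argmin_SP [FiniteDimensional ℝ E₁] (hP : P.Admissible c) (hc : c.Valid) (l : E₂) :
    ∃ x ∈ P.X, P.psiHatD l = P.SP x l ∧
      ∀ x' ∈ P.X, P.psiHatD l + c.μ / 2 * ‖x' - x‖ ^ 2 ≤ P.SP x' l := by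
  have hcont : ContinuousOn (fun x => P.f x + P.Φ x l) P.X :=
    hP.f_continuousOn.add (hP.differentiable_left l).continuous.continuousOn
  obtain ⟨x, hx, hmin⟩ := LowerSemicontinuousOn.exists_isMinOn hP.X_nonempty hP.X_compact
    (hcont.lowerSemicontinuousOn.add hP.g_closed)
  have hq := (hP.f_quadConvexOn.add (quadConvexOn_of_convexOn
    ((hP.Φ_convex l).subset (subset_univ _) hP.X_convex) (fun u => ‖u‖ ^ 2))).add
      (quadConvexOn_of_convexOn hP.g_convex (fun u => ‖u‖ ^ 2))
  have hstrong : ∀ x' ∈ P.X, P.SP x l + c.μ / 2 * ‖x' - x‖ ^ 2 ≤ P.SP x' l := by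
    intro x' hx'
    have := hq.add_le_of_isMinOn hP.X_convex hx' hx hmin
    simp only [add_zero] at this
    simp only [SP]
    linarith
  have heq : P.psiHatD l = P.SP x l := by
    refine IsLeast.csInf_eq ⟨mem_image_of_mem _ hx, ?_⟩
    rintro _ ⟨x', hx', rfl⟩
    have := hstrong x' hx'
    have h2 : 0 ≤ c.μ / 2 * ‖x' - x‖ ^ 2 := mul_nonneg (half_pos hc.mu_pos).le (sq_nonneg _)
    simp only
    linarith
  exact ⟨x, hx, heq, heq ▸ hstrong⟩

theorem psiHatD_le_SP [FiniteDimensional ℝ E₁] (hP : P.Admissible c) (hc : c.Valid) (l : E₂)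
    {x : E₁} (hx : x ∈ P.X) : P.psiHatD l ≤ P.SP x l := by
  obtain ⟨x', -, -, h⟩ := hP.exists_argmin_SP hc l
  have := h x hx
  have h2 : 0 ≤ c.μ / 2 * ‖x - x'‖ ^ 2 := mul_nonneg (half_pos hc.mu_pos).le (sq_nonneg _)
  linarith

theorem psiP_eq [FiniteDimensional ℝ E₂] (hP : P.Admissible c) (x : E₁) :
    P.psiP x = P.f x + P.g x + P.psiHatP 0 x := by
  obtain ⟨l, hl, h1, h2⟩ := hP.exists_argmax_SD le_rfl x
  rw [h1]
  have e : ∀ l, P.S x l = P.f x + P.g x + P.SD 0 x l := fun l => by simp only [S, SD]; ring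
  rw [← e]
  refine IsGreatest.csSup_eq ⟨mem_image_of_mem _ hl, ?_⟩
  rintro _ ⟨l', hl', rfl⟩
  have := h2 l' hl'
  rw [h1] at this
  simp only [e]
  linarith

theorem psiD_eq [FiniteDimensional ℝ E₁] (hP : P.Admissible c) (hc : c.Valid) (l : E₂) :
    P.psiD l = P.psiHatD l - P.h l := by
  obtain ⟨x, hx, h1, -⟩ := hP.exists_argmin_SP hc l
  rw [h1]
  refine IsLeast.csInf_eq ⟨⟨x, hx, rfl⟩, ?_⟩
  rintro _ ⟨x', hx', rfl⟩
  have := hP.psiHatD_le_SP hc l hx'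
  rw [h1] at this
  exact sub_le_sub_right this _

theorem abs_gap_sub_smoothedGap_le [FiniteDimensional ℝ E₁] [FiniteDimensional ℝ E₂]
    (hP : P.Admissible c) (hc : c.Valid) {b ρ : ℝ} (hb : ∀ l ∈ P.Λ, |P.ω l| ≤ b) (hρ : 0 ≤ ρ)
    (x : E₁) (l : E₂) : |P.gap x l - P.smoothedGap ρ x l| ≤ ρ * b := by
  obtain ⟨l₀, hl₀, e₀, -⟩ := hP.exists_argmax_SD le_rfl x
  obtain ⟨l₁, hl₁, e₁, -⟩ := hP.exists_argmax_SD hρ x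
  have h0 := hP.SD_le_psiHatP hρ x hl₀
  have h1 := hP.SD_le_psiHatP le_rfl x hl₁
  have b0 := mul_le_mul_of_nonneg_left (abs_le.1 (hb _ hl₀)).2 hρ
  have b1 := mul_le_mul_of_nonneg_left (abs_le.1 (hb _ hl₁)).1 hρ
  simp only [SD] at h0 h1 e₀ e₁
  rw [gap, hP.psiP_eq, hP.psiD_eq hc, smoothedGap, abs_le]
  constructor <;> linarith

/-- An inexact solution of the primal subproblem at `l'` gives an inexact first-order model of the
concave function `psiHatD`. -/
theorem inexact_model_le [FiniteDimensional ℝ E₁] (hP : P.Admissible c)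
    (hc : c.Valid) {γ : ℝ} {l l' : E₂} (hl : l ∈ P.Λ) (hl' : l' ∈ P.Λ) {x : E₁}
    (hx : P.IsInexactPrimal γ l' x) :
    P.SP x l' + P.gradL x l' (l - l') - c.LD / 2 * ‖l - l'‖ ^ 2 - 2 * γ ≤ P.psiHatD l := by
  obtain ⟨hxX, hγ⟩ := hx
  obtain ⟨y, hy, ey, hy'⟩ := hP.exists_argmin_SP hc l'
  obtain ⟨z, hz, ez, -⟩ := hP.exists_argmin_SP hc l
  have h1 := hP.linearization_right_le hz hl hl'
  have h2 := hy' z hz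
  have h3 := hy' x hxX
  have h4 : P.gradL x l' (l - l') - c.Llx * ‖z - x‖ * ‖l - l'‖ ≤ P.gradL z l' (l - l') := by
    have a1 := (P.gradL x l' - P.gradL z l').le_opNorm (l - l')
    have a2 := hP.smooth_lx x hxX z hz l' hl'
    have a3 := mul_le_mul_of_nonneg_right a2 (norm_nonneg (l - l'))
    have a4 := le_abs_self ((P.gradL x l' - P.gradL z l') (l - l'))
    rw [sub_apply] at a4
    rw [sub_apply, Real.norm_eq_abs] at a1
    rw [norm_sub_rev x z] at a3
    linarith
  have h5 : ‖z - x‖ ≤ ‖z - y‖ + ‖x - y‖ := by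
    have := norm_sub_le_norm_sub_add_norm_sub z y x
    rwa [norm_sub_rev y x] at this
  have h6 := mul_le_mul_of_nonneg_right (mul_le_mul_of_nonneg_left h5 hc.Llx_nonneg)
    (norm_nonneg (l - l'))
  have eLD : c.LD / 2 * ‖l - l'‖ ^ 2 = c.Lll / 2 * ‖l - l'‖ ^ 2
      + 2 * ((c.Llx * ‖l - l'‖) ^ 2 / (2 * c.μ)) := by
    have := hc.mu_pos.ne'
    rw [Constants.LD]; field_simp
  -- Applied twice, with `y` the exact minimizer at `l'`. The term in `‖z - y‖` is absorbed by
  -- strong convexity; the one in `‖x - y‖` costs a second `γ`. Together the two remainders form the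
  -- part `2 Llx² / μ` of `LD`.
  have young : ∀ r : ℝ, r * (c.Llx * ‖l - l'‖)
      ≤ c.μ / 2 * r ^ 2 + (c.Llx * ‖l - l'‖) ^ 2 / (2 * c.μ) := by
    intro r
    have hμ := hc.mu_pos
    have e : c.μ / 2 * r ^ 2 + (c.Llx * ‖l - l'‖) ^ 2 / (2 * c.μ) - r * (c.Llx * ‖l - l'‖)
        = (c.μ * r - c.Llx * ‖l - l'‖) ^ 2 / (2 * c.μ) := by field_simp; ring
    have : 0 ≤ (c.μ * r - c.Llx * ‖l - l'‖) ^ 2 / (2 * c.μ) := by positivity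
    linarith
  have h7 := young ‖z - y‖
  have h8 := young ‖x - y‖
  rw [ez, eLD]
  simp only [SP] at h2 h3 hγ ⊢
  linarith

theorem psiHatD_le_model [FiniteDimensional ℝ E₁] (hP : P.Admissible c) (hc : c.Valid) (l l' : E₂)
    {x : E₁} (hx : x ∈ P.X) : P.psiHatD l ≤ P.SP x l' + P.gradL x l' (l - l') := by
  have h1 := hP.psiHatD_le_SP hc l hx
  have h2 := hP.le_linearization_right x l l'
  simp only [SP] at h1 ⊢
  linarith

/-- The model of `psiHatD` at `λ̂`, evaluated at the new dual point, is the `τ`-combination of its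
values at `l`, where it dominates `psiHatD l`, and at `lt'`, where concavity of `Φ` bounds it below.
The factor in `τ ρ` makes the regularizer of the new gap equal to `τ` times the old one. The
curvature term is of order `‖lt' - lt‖²`, since `λ̂` and the new dual point differ by `(1 - τ)(lt' -
lt)`. -/
theorem smoothedGap_step [FiniteDimensional ℝ E₁] [FiniteDimensional ℝ E₂]
    (hP : P.Admissible c) (hc : c.Valid) {x xt : E₁} {l lt lt' : E₂} {ρ τ γ η : ℝ} (hρ : 0 < ρ)
    (hτ0 : 0 ≤ τ) (hτ1 : τ ≤ 1) (hτ : c.LD * (1 - τ) ^ 2 ≤ τ * ρ / 4) (hx : x ∈ P.X)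
    (hl : l ∈ P.Λ) (hlt : P.IsInexactDual ρ η x lt)
    (hxt : P.IsInexactPrimal γ (τ • l + (1 - τ) • lt) xt)
    (hlt' : P.IsInexactDual (τ * ρ) η (τ • x + (1 - τ) • xt) lt') :
    P.smoothedGap (τ * ρ) (τ • x + (1 - τ) • xt) (τ • l + (1 - τ) • lt')
      ≤ τ * P.smoothedGap ρ x l + η + 2 * γ + τ * η / 2 := by
  obtain ⟨hltΛ, hη⟩ := hlt
  obtain ⟨hltΛ', hη'⟩ := hlt'
  have hσ : 0 ≤ 1 - τ := by linarith
  have hlh := hP.Λ_convex hl hltΛ hτ0 hσ (by ring)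
  have hlp := hP.Λ_convex hl hltΛ' hτ0 hσ (by ring)
  have m1 := hP.inexact_model_le hc hlp hlh hxt
  obtain ⟨hxtX, -⟩ := hxt
  have m2 := mul_le_mul_of_nonneg_left
    (hP.psiHatD_le_model hc l (τ • l + (1 - τ) • lt) hxtX) hτ0
  have m3 := mul_le_mul_of_nonneg_left
    (hP.le_linearization_right xt lt' (τ • l + (1 - τ) • lt)) hσ
  have e1 : τ • l + (1 - τ) • lt' - (τ • l + (1 - τ) • lt) = (1 - τ) • (lt' - lt) := by module
  have e2 : P.gradL xt (τ • l + (1 - τ) • lt)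
        (τ • l + (1 - τ) • lt' - (τ • l + (1 - τ) • lt))
      = τ * P.gradL xt (τ • l + (1 - τ) • lt) (l - (τ • l + (1 - τ) • lt))
        + (1 - τ) * P.gradL xt (τ • l + (1 - τ) • lt) (lt' - (τ • l + (1 - τ) • lt)) := by
    rw [← smul_eq_mul, ← smul_eq_mul, ← map_smul, ← map_smul, ← map_add]
    congr 1; module
  rw [e2, e1, norm_smul, Real.norm_of_nonneg hσ, mul_pow] at m1
  set lh := τ • l + (1 - τ) • lt
  have hf := (hP.f_quadConvexOn x hx xt hxtX τ (1 - τ) hτ0 hσ (by ring)).trans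
    (sub_le_self _ (mul_nonneg (mul_nonneg hτ0 hσ)
      (mul_nonneg (half_pos hc.mu_pos).le (sq_nonneg _))))
  have hg := hP.g_convex.2 hx hxtX hτ0 hσ (by ring)
  have hh := hP.h_convex.2 hl hltΛ' hτ0 hσ (by ring)
  have hΦ := (hP.Φ_convex lt').2 (mem_univ x) (mem_univ xt) hτ0 hσ (by ring)
  simp only [smul_eq_mul] at hg hh hΦ
  obtain ⟨ls, hls, -, hs⟩ := hP.exists_argmax_SD hρ.le x
  have s1 := mul_le_mul_of_nonneg_left (hs lt' hltΛ') hτ0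
  have s2 := hs lt hltΛ
  -- Through the exact maximizer `ls`: the first term is absorbed by strong concavity at `ls`, the
  -- second is controlled by the inexactness `η` and produces `τη/2`.
  have tri : ‖lt' - lt‖ ^ 2 ≤ 2 * ‖lt' - ls‖ ^ 2 + 2 * ‖lt - ls‖ ^ 2 := by
    have h1 := norm_sub_le_norm_sub_add_norm_sub lt' ls lt
    rw [norm_sub_rev ls lt] at h1
    nlinarith [norm_nonneg (lt' - lt), sq_nonneg (‖lt' - ls‖ - ‖lt - ls‖)]
  have t1 := mul_le_mul_of_nonneg_right hτ (sq_nonneg ‖lt' - lt‖)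
  have t2 := mul_le_mul_of_nonneg_left tri (by positivity : 0 ≤ τ * ρ / 4)
  have t3 : τ * (ρ / 2 * ‖lt - ls‖ ^ 2) ≤ τ * η := mul_le_mul_of_nonneg_left (by linarith) hτ0
  have t4 : 0 ≤ τ * ρ * ‖lt' - ls‖ ^ 2 := by positivity
  simp only [SD] at hη' s1
  simp only [smoothedGap]
  simp only [SP] at m1 m2
  linear_combination m1 + m2 + m3 + hf + hg + hh + hΦ + hη' + s1 + t1 / 2 + t2 / 2 + t3 / 2 + t4 / 4

end Admissible

end SaddleProblem

/-! ### Convergence of the outer iteration -/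

section Convergence

variable [FiniteDimensional ℝ E₁] [FiniteDimensional ℝ E₂] {I : Input E₁ E₂} {ε : ℝ}

/-- One iteration from feasible points, with the accuracies it attains. -/
theorem iteration_spec (hI : I.Admissible) (hc : I.c.Valid) (hθ₁ : 1 ≤ I.θ₁) (hθ₂ : 1 ≤ I.θ₂)
    (hε : 0 < ε) (hp : I.HasParameters ε) (k : ℕ) {st : State E₁ E₂} (hx : st.x ∈ I.P.X)
    (hl : st.l ∈ I.P.Λ) (hρ : 0 < st.ρ) :
    I.P.IsInexactDual st.ρ (I.η k) st.x (stepDual₁ I k st).val ∧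
    I.P.IsInexactPrimal (I.γ k) (lamHat I k st) (stepPrimal I k st).val ∧
    nextX I k st ∈ I.P.X ∧
    I.P.IsInexactDual (I.τ k * st.ρ) (I.η k) (nextX I k st) (stepDual₂ I k st).val ∧
    I.τ k • st.l + (1 - I.τ k) • (stepDual₂ I k st).val ∈ I.P.Λ := by
  have hτ0 : 0 < I.τ k := by rw [hp.τ_eq]; positivity
  have hτ1 : 0 ≤ 1 - I.τ k := by
    rw [hp.τ_eq, sub_nonneg, div_le_one (by positivity)]; linarith
  have hη : 0 < I.η k := by rw [hp.η_eq]; positivity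
  have hγ : 0 < I.γ k := by rw [hp.γ_eq]; positivity
  have h1 := solveDual_spec hI hc hθ₂ hρ hη (hI.innerL_mem k) hx
  have hlh : lamHat I k st ∈ I.P.Λ :=
    hI.problem.Λ_convex hl h1.1 hτ0.le hτ1 (by ring)
  have h2 := solvePrimal_spec hI hc hθ₁ hγ (hI.innerX_mem k) hlh
  have hnx : nextX I k st ∈ I.P.X := hI.problem.X_convex hx h2.1 hτ0.le hτ1 (by ring)
  have h3 := solveDual_spec hI hc hθ₂ (mul_pos hτ0 hρ) hη (hI.innerL'_mem k) hnx
  exact ⟨h1, h2, hnx, h3, hI.problem.Λ_convex hl h3.1 hτ0.le hτ1 (by ring)⟩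

/-- The weight `(k+1)(k+2)` is dictated by `τ_k = (k+1)(k+2) / ((k+2)(k+3))`, and the shift `ε/2`
absorbs the accumulated subproblem errors. -/
theorem run_spec (hI : I.Admissible) (hc : I.c.Valid) (hθ₁ : 1 ≤ I.θ₁) (hθ₂ : 1 ≤ I.θ₂)
    (hε : 0 < ε) (hp : I.HasParameters ε) (k : ℕ) :
    (run I k).x ∈ I.P.X ∧ (run I k).l ∈ I.P.Λ ∧
    (run I k).ρ = 16 * I.c.LD / (((k : ℝ) + 1) * (k + 2)) ∧
    ((k : ℝ) + 1) * (k + 2) *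
      (I.P.smoothedGap (run I k).ρ (run I k).x (run I k).l - ε / 2)
      ≤ 2 * I.P.smoothedGap I.ρ₀ I.x₀ I.l₀ := by
  induction k with
  | zero =>
    refine ⟨hI.x₀_mem, hI.l₀_mem, ?_, ?_⟩
    · change I.ρ₀ = _
      rw [hp.ρ₀_eq]; push_cast; ring
    · change (((0 : ℕ) : ℝ) + 1) * ((0 : ℕ) + 2) *
        (I.P.smoothedGap I.ρ₀ I.x₀ I.l₀ - ε / 2) ≤ _
      push_cast; linarith
  | succ k ih =>
    obtain ⟨hx, hl, hρ, hgap⟩ := ih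
    have hLD := hc.LD_pos
    have hρ0 : 0 < (run I k).ρ := by rw [hρ]; positivity
    obtain ⟨h1, h2, hnx, h3, hnl⟩ := iteration_spec hI hc hθ₁ hθ₂ hε hp k hx hl hρ0
    have hτ := hp.τ_eq k
    have hk : (0 : ℝ) ≤ k := Nat.cast_nonneg k
    have hρ' : I.τ k * (run I k).ρ = 16 * I.c.LD / (((k : ℝ) + 2) * (k + 3)) := by
      rw [hτ, hρ]; field_simp
    refine ⟨hnx, hnl, ?_, ?_⟩
    · change I.τ k * (run I k).ρ = _
      rw [hρ']; push_cast; ring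
    · have hcond : I.c.LD * (1 - I.τ k) ^ 2 ≤ I.τ k * (run I k).ρ / 4 := by
        rw [hρ', hτ]
        have e : 1 - ((k : ℝ) + 1) / (k + 3) = 2 / (k + 3) := by field_simp; ring
        rw [e, div_pow, mul_div_assoc', div_div, div_le_div_iff₀ (by positivity) (by positivity)]
        nlinarith [mul_nonneg hLD.le (by positivity : 0 ≤ ((k : ℝ) + 3))]
      have hs := hI.problem.smoothedGap_step hc hρ0 (by rw [hτ]; positivity)
        (by rw [hτ, div_le_one (by positivity)]; linarith) hcond hx hl h1 h2 h3
      change _ * (I.P.smoothedGap (I.τ k * (run I k).ρ) (nextX I k (run I k))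
        (I.τ k • (run I k).l + (1 - I.τ k) • (stepDual₂ I k (run I k)).val) - ε / 2) ≤ _
      change I.P.smoothedGap (I.τ k * (run I k).ρ) (nextX I k (run I k))
        (I.τ k • (run I k).l + (1 - I.τ k) • (stepDual₂ I k (run I k)).val) ≤ _ at hs
      refine le_trans ?_ hgap
      set g' := I.P.smoothedGap (I.τ k * (run I k).ρ) (nextX I k (run I k))
        (I.τ k • (run I k).l + (1 - I.τ k) • (stepDual₂ I k (run I k)).val)
      set g := I.P.smoothedGap (run I k).ρ (run I k).x (run I k).l
      rw [hp.γ_eq, hp.η_eq, hτ] at hs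
      have e : ((k : ℝ) + 3) * (((k : ℝ) + 1) / (k + 3) * g + ε / (4 * (k + 3))
          + 2 * (ε / (4 * (k + 3))) + ((k : ℝ) + 1) / (k + 3) * (ε / (4 * (k + 3))) / 2)
          = (k + 1) * g + ε * (3 / 4 + (k + 1) / (k + 3) / 8) := by
        field_simp; ring
      have hs' := mul_le_mul_of_nonneg_left hs (by positivity : (0 : ℝ) ≤ k + 3)
      rw [e] at hs'
      have hr : ((k : ℝ) + 1) / (k + 3) ≤ 1 := by rw [div_le_one (by positivity)]; linarith
      -- The errors of one step add up to at most `(7/8) ε / (k + 3)`, below the available `(1 -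
      -- τ_k) ε/2 = ε / (k + 3)`.
      have hs'' : ((k : ℝ) + 3) * (g' - ε / 2) ≤ (k + 1) * (g - ε / 2) := by
        have := mul_le_mul_of_nonneg_left hr hε.le
        linarith
      have := mul_le_mul_of_nonneg_left hs'' (by positivity : (0 : ℝ) ≤ k + 2)
      push_cast
      linarith

theorem subproblemsSolved (hI : I.Admissible) (hc : I.c.Valid) (hθ₁ : 1 ≤ I.θ₁)
    (hθ₂ : 1 ≤ I.θ₂) (hε : 0 < ε) (hp : I.HasParameters ε) : SubproblemsSolved I := by
  intro k
  obtain ⟨hx, hl, hρ, -⟩ := run_spec hI hc hθ₁ hθ₂ hε hp k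
  have hLD := hc.LD_pos
  have hρ0 : 0 < (run I k).ρ := by rw [hρ]; positivity
  obtain ⟨h1, h2, -, h3, -⟩ := iteration_spec hI hc hθ₁ hθ₂ hε hp k hx hl hρ0
  exact ⟨h1, h2, h3⟩

/-- Half of `ε` is used by the errors. In the other half, `32 LD b` is `16 LD b` for smoothing the
initial gap (`2 ρ₀ b`) plus `16 LD b` for unsmoothing the final one. -/
theorem gap_run_le (hI : I.Admissible) (hc : I.c.Valid) (hθ₁ : 1 ≤ I.θ₁) (hθ₂ : 1 ≤ I.θ₂)
    (hε : 0 < ε) (hp : I.HasParameters ε) {b Δ₀ : ℝ} (hb : ∀ l ∈ I.P.Λ, |I.P.ω l| ≤ b)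
    (hΔ : I.P.gap I.x₀ I.l₀ ≤ Δ₀) {k : ℕ}
    (hk : 2 * (2 * Δ₀ + 32 * I.c.LD * b) ≤ ((k : ℝ) + 1) * (k + 2) * ε) :
    I.P.gap (run I k).x (run I k).l ≤ ε := by
  obtain ⟨-, -, hρ, hgap⟩ := run_spec hI hc hθ₁ hθ₂ hε hp k
  have hLD := hc.LD_pos
  have hρ0 : 0 ≤ (run I k).ρ := by rw [hρ]; positivity
  have hρ₀ : 0 ≤ I.ρ₀ := by rw [hp.ρ₀_eq]; positivity
  have h1 := (abs_le.1 (hI.problem.abs_gap_sub_smoothedGap_le hc hb hρ0 (run I k).x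
    (run I k).l)).2
  have h2 := (abs_le.1 (hI.problem.abs_gap_sub_smoothedGap_le hc hb hρ₀ I.x₀ I.l₀)).1
  rw [hp.ρ₀_eq] at h2 hgap
  have hq : (0 : ℝ) < ((k : ℝ) + 1) * (k + 2) := by positivity
  have h3 : ((k : ℝ) + 1) * (k + 2) * ((run I k).ρ * b) = 16 * I.c.LD * b := by
    rw [hρ]; field_simp
  refine le_of_mul_le_mul_left ?_ hq
  have := mul_le_mul_of_nonneg_left h1 hq.le
  linarith

end Convergence
end IPDS

namespace IPDS

/-! ### Counting inner iterations and oracle calls -/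

section Complexity

/-- With `s = √(μ/(2L)) ≥ 1/X`, `log (1 + s) ≥ s/(1 + s) ≥ 1/(1 + X)`; so `2ℓ(1 + X)` steps, rounded
up, give a power of at least `exp (4ℓ)`. -/
theorem apgIterations_le {L μ D acc ℓ X : ℝ} (hL : 0 < L) (hμ : 0 < μ) (hacc : 0 < acc)
    (hℓ : 0 ≤ ℓ) (hX : 0 ≤ X) (hLX : 2 * L / μ ≤ X ^ 2)
    (h : L / 4 * D ^ 2 ≤ acc * Real.exp ℓ ^ 4) :
    (apgIterations L μ D acc : ℝ) ≤ 2 + 2 * ℓ * (1 + X) := by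
  set s := √(μ / (2 * L)) with hs
  have hs0 : 0 < s := Real.sqrt_pos.2 (by positivity)
  have hsX : 1 ≤ s * X := by
    have h1 : 1 ≤ (s * X) ^ 2 := by
      rw [mul_pow, hs, Real.sq_sqrt (by positivity)]
      refine le_trans (le_of_eq ?_) (mul_le_mul_of_nonneg_left hLX (by positivity))
      field_simp
    exact (one_le_sq_iff₀ (by positivity)).1 h1
  set m := ⌈2 * ℓ * (1 + X)⌉₊ with hm
  have hmle : 2 * ℓ * (1 + X) ≤ m := Nat.le_ceil _
  have hmlt : (m : ℝ) < 2 * ℓ * (1 + X) + 1 := Nat.ceil_lt_add_one (by positivity)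
  have hlog : 1 - (1 + s)⁻¹ ≤ Real.log (1 + s) := Real.one_sub_inv_le_log_of_pos (by linarith)
  have hlog1 : 1 ≤ (1 + X) * Real.log (1 + s) := by
    refine le_trans ?_ (mul_le_mul_of_nonneg_left hlog (by positivity))
    have e : 1 - (1 + s)⁻¹ = s / (1 + s) := by field_simp; ring
    rw [e, mul_div_assoc', le_div_iff₀ (by positivity)]
    linarith
  have hpow : Real.exp ℓ ^ 4 ≤ (1 + s) ^ (2 * (m + 1 - 1)) := by
    rw [Nat.add_sub_cancel, ← Real.exp_log (by linarith : 0 < 1 + s), ← Real.exp_nat_mul,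
      ← Real.exp_nat_mul, Real.exp_le_exp]
    push_cast
    have hlog0 : 0 ≤ Real.log (1 + s) := Real.log_nonneg (by linarith)
    have h1 := mul_le_mul_of_nonneg_right hmle hlog0
    have h2 := mul_le_mul_of_nonneg_left hlog1 hℓ
    linarith
  have hle : apgIterations L μ D acc ≤ m + 1 :=
    Nat.sInf_le ⟨by omega, h.trans (mul_le_mul_of_nonneg_left hpow hacc.le)⟩
  have : (apgIterations L μ D acc : ℝ) ≤ m + 1 := by exact_mod_cast hle
  linarith

/-- The source of `ε₀`: `M` collects the diameter, distortion and gap constants, whose contribution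
of order `M / ε²` is dominated by `(p / ε)⁴`. -/
theorem exists_threshold {p M : ℝ} (hp : 0 < p) (hM : 0 ≤ M) :
    ∃ ε₀ : ℝ, 0 < ε₀ ∧ ∀ ε, 0 < ε → ε ≤ ε₀ → 1 ≤ Real.log (p / ε) ∧ M * ε ^ 2 ≤ p ^ 4 := by
  refine ⟨min 1 (min (p / 3) (p ^ 4 / (M + 1))), by positivity, fun ε hε h => ?_⟩
  have h1 := h.trans (min_le_left _ _)
  have h2 := h.trans ((min_le_right _ _).trans (min_le_left _ _))
  have h3 := h.trans ((min_le_right _ _).trans (min_le_right _ _))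
  constructor
  · rw [Real.le_log_iff_exp_le (by positivity), le_div_iff₀ hε]
    have := Real.exp_one_lt_d9
    nlinarith
  · rw [le_div_iff₀ (by positivity)] at h3
    have : ε ^ 2 ≤ ε := by nlinarith
    nlinarith [mul_le_mul_of_nonneg_left this hM]

/-- The number of inner iterations for accuracy `ε / (4 (k + 3))` when `ε` is below the threshold
and `k + 3` is at most of order `1 / ε`. -/
theorem apgIterations_le_of_threshold {L μ θ d D T X p ε : ℝ} {k : ℕ} (hL : 0 < L) (hμ : 0 < μ)
    (hp : 0 < p) (hε : 0 < ε) (hd0 : 0 ≤ d) (hd : d ≤ D) (hk : ((k : ℝ) + 3) ≤ T / ε)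
    (hlog : 1 ≤ Real.log (p / ε)) (hthr : L * θ ^ 2 * D ^ 2 * T * ε ^ 2 ≤ p ^ 4)
    (hX : 0 ≤ X) (hLX : 2 * L / μ ≤ X ^ 2) :
    (apgIterations L μ (θ * d) (ε / (4 * ((k : ℝ) + 3))) : ℝ)
      ≤ 2 + 2 * Real.log (p / ε) * (1 + X) := by
  refine apgIterations_le hL hμ (by positivity) (by linarith) hX hLX ?_
  rw [Real.exp_log (by positivity), div_pow, div_mul_div_comm, le_div_iff₀ (by positivity)]
  have h1 : (θ * d) ^ 2 ≤ θ ^ 2 * D ^ 2 := by rw [mul_pow]; gcongr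
  rw [le_div_iff₀ hε] at hk
  calc L / 4 * (θ * d) ^ 2 * (4 * ((k : ℝ) + 3) * ε ^ 4)
      = L * (θ * d) ^ 2 * (((k : ℝ) + 3) * ε) * ε ^ 3 := by ring
    _ ≤ L * (θ ^ 2 * D ^ 2) * T * ε ^ 3 := by gcongr
    _ = ε * (L * θ ^ 2 * D ^ 2 * T * ε ^ 2) := by ring
    _ ≤ ε * p ^ 4 := by gcongr

variable {E₁ : Type u} [NormedAddCommGroup E₁] [NormedSpace ℝ E₁]
  {E₂ : Type v} [NormedAddCommGroup E₂] [NormedSpace ℝ E₂]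

theorem primalCalls_run_le (I : Input E₁ E₂) {K : ℕ} {m : ℝ}
    (h : ∀ k < K, (((stepPrimal I k (run I k)).calls : ℕ) : ℝ) ≤ m) :
    ((run I K).primalCalls : ℝ) ≤ K * m := by
  induction K with
  | zero => change ((0 : ℕ) : ℝ) ≤ _; simp
  | succ K ih =>
    change (((run I K).primalCalls + (stepPrimal I K (run I K)).calls : ℕ) : ℝ) ≤ _
    have h1 := ih fun k hk => h k (by omega)
    have h2 := h K (by omega)
    push_cast
    linarith

theorem dualCalls_run_le (I : Input E₁ E₂) {K : ℕ} {m : ℝ}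
    (h₁ : ∀ k < K, (((stepDual₁ I k (run I k)).calls : ℕ) : ℝ) ≤ m)
    (h₂ : ∀ k < K, (((stepDual₂ I k (run I k)).calls : ℕ) : ℝ) ≤ m) :
    ((run I K).dualCalls : ℝ) ≤ K * (2 * m) := by
  induction K with
  | zero => change ((0 : ℕ) : ℝ) ≤ _; simp
  | succ K ih =>
    change (((run I K).dualCalls + (stepDual₁ I K (run I K)).calls
      + (stepDual₂ I K (run I K)).calls : ℕ) : ℝ) ≤ _
    have h1 := ih (fun k hk => h₁ k (by omega)) (fun k hk => h₂ k (by omega))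
    have h2 := h₁ K (by omega)
    have h3 := h₂ K (by omega)
    push_cast
    linarith

theorem solvePrimal_calls (I : Input E₁ E₂) (γ : ℝ) (start : E₁) (l : E₂) :
    (solvePrimal I γ start l).calls = 2 * (I.P.n + 1) *
      apgIterations (I.c.L + I.c.Lxx) (I.c.μ / I.θ₁ ^ 2) (I.θ₁ * Metric.diam I.P.X) γ :=
  apgSolve_calls (primalInput_grad_calls I start l) _ _

theorem solveDual_calls (I : Input E₁ E₂) (ρ η : ℝ) (start : E₂) (x : E₁) :
    (solveDual I ρ η start x).calls = 2 * I.P.n *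
      apgIterations I.c.Lll (ρ / I.θ₂ ^ 2) (I.θ₂ * Metric.diam I.P.Λ) η :=
  apgSolve_calls (dualInput_grad_calls I ρ start x) _ _

variable {I : Input E₁ E₂} {ε q D R : ℝ} {K : ℕ}

theorem primalCalls_le (hc : I.c.Valid) (hn : 0 < I.P.n) (hθ : 1 ≤ I.θ₁)
    (hp : I.HasParameters ε) (hε : 0 < ε) (hD : Metric.diam I.P.X ≤ D)
    (hq : 0 ≤ q) (hR : R = √(I.c.LD * q / ε)) (hR1 : 1 ≤ R) (hK : (K : ℝ) ≤ 9 * R)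
    (hlog : 1 ≤ Real.log ((I.c.L + I.c.Lxx) * I.c.LD / ε))
    (hthr : (I.c.L + I.c.Lxx) * I.θ₁ ^ 2 * D ^ 2 * (11 * (I.c.LD * q)) * ε ^ 2
      ≤ ((I.c.L + I.c.Lxx) * I.c.LD) ^ 4) :
    ((run I K).primalCalls : ℝ) ≤ 1000 * I.θ₁ * √q *
      (I.P.n * √(I.c.kappa * I.c.LD / ε) * Real.log ((I.c.L + I.c.Lxx) * I.c.LD / ε)) := by
  have hLD := hc.LD_pos
  have hμ := hc.mu_pos
  have hL : 0 < I.c.L + I.c.Lxx := by linarith [hc.mu_le, hc.Lxx_nonneg]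
  have hR2 : R ^ 2 = I.c.LD * q / ε := by rw [hR, Real.sq_sqrt (by positivity)]
  set ℓ := Real.log ((I.c.L + I.c.Lxx) * I.c.LD / ε)
  have hκ1 : 1 ≤ I.c.kappa := by
    rw [Constants.kappa, le_div_iff₀ hμ]; linarith [hc.mu_le, hc.Lxx_nonneg]
  set Y := I.θ₁ * √I.c.kappa with hY
  have hY1 : 1 ≤ Y := one_le_mul_of_one_le_of_one_le hθ (Real.one_le_sqrt.2 hκ1)
  have hn1 : (1 : ℝ) ≤ I.P.n := by exact_mod_cast hn
  have hcalls : ∀ k < K, (((stepPrimal I k (run I k)).calls : ℕ) : ℝ)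
      ≤ 28 * I.P.n * (ℓ * Y) := by
    intro k hk
    have hk1 : (k : ℝ) + 1 ≤ K := by exact_mod_cast hk
    have hk3 : (k : ℝ) + 3 ≤ 11 * (I.c.LD * q) / ε := by
      rw [mul_div_assoc, ← hR2]; nlinarith
    -- The requirement is `X² ≥ 2 Y²`, and `3/2 > √2`.
    have hit := apgIterations_le_of_threshold (k := k) (X := 3 / 2 * Y) (μ := I.c.μ / I.θ₁ ^ 2) hL
      (by positivity) (by positivity) hε Metric.diam_nonneg hD hk3 hlog hthr (by positivity) (by
        rw [hY, mul_pow, mul_pow, Real.sq_sqrt (by linarith), Constants.kappa]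
        have : 0 < (I.c.L + I.c.Lxx) / I.c.μ * I.θ₁ ^ 2 := by positivity
        have e : 2 * (I.c.L + I.c.Lxx) / (I.c.μ / I.θ₁ ^ 2)
          = 2 * ((I.c.L + I.c.Lxx) / I.c.μ * I.θ₁ ^ 2) := by field_simp
        rw [e]; linarith)
    rw [stepPrimal, solvePrimal_calls, hp.γ_eq]
    push_cast
    have hℓY : ℓ ≤ ℓ * Y := le_mul_of_one_le_right (by linarith) hY1
    calc 2 * ((I.P.n : ℝ) + 1) * _ ≤ 2 * (I.P.n + I.P.n) * (7 * (ℓ * Y)) := by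
          gcongr
          refine hit.trans ?_
          linarith
      _ = _ := by ring
  refine (primalCalls_run_le I hcalls).trans ?_
  have hRκ : R * √I.c.kappa = √q * √(I.c.kappa * I.c.LD / ε) := by
    rw [hR, ← Real.sqrt_mul (by positivity), ← Real.sqrt_mul hq]
    congr 1; ring
  calc (K : ℝ) * (28 * I.P.n * (ℓ * Y)) ≤ 9 * R * (28 * I.P.n * (ℓ * Y)) := by gcongr
    _ = 252 * I.θ₁ * (R * √I.c.kappa) * (I.P.n * ℓ) := by rw [hY]; ring
    _ = 252 * I.θ₁ * √q * (I.P.n * √(I.c.kappa * I.c.LD / ε) * ℓ) := by rw [hRκ]; ring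
    _ ≤ _ := by gcongr; norm_num

/-- Each dual solve is bounded by its cost at the smallest `ρ`, of order `LD / R²`, hence by order
`ℓ W` inner iterations with `W` proportional to `R`. Multiplying by `K ≤ 9R` gives `R²`, which is
why `q` and `1/ε` appear without square root. -/
theorem dualCalls_le [FiniteDimensional ℝ E₁] [FiniteDimensional ℝ E₂] (hI : I.Admissible)
    (hc : I.c.Valid) (hθ₁ : 1 ≤ I.θ₁) (hθ : 1 ≤ I.θ₂)
    (hp : I.HasParameters ε) (hε : 0 < ε) (hD : Metric.diam I.P.Λ ≤ D)
    (hq : 1 ≤ q) (hR : R = √(I.c.LD * q / ε)) (hR1 : 1 ≤ R) (hK : (K : ℝ) ≤ 9 * R)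
    (hL : 0 < I.c.Lll) (hεL : ε ≤ I.c.Lll)
    (hlog : 1 ≤ Real.log (I.c.Lll * I.c.LD / ε))
    (hthr : I.c.Lll * I.θ₂ ^ 2 * D ^ 2 * (11 * (I.c.LD * q)) * ε ^ 2
      ≤ (I.c.Lll * I.c.LD) ^ 4) :
    ((run I K).dualCalls : ℝ) ≤ 1000 * I.θ₂ * q *
      (I.P.n * (√(I.c.Lll * I.c.LD) / ε) * Real.log (I.c.Lll * I.c.LD / ε)) := by
  have hLD := hc.LD_pos
  have hR2 : R ^ 2 = I.c.LD * q / ε := by rw [hR, Real.sq_sqrt (by positivity)]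
  set ℓ := Real.log (I.c.Lll * I.c.LD / ε)
  set W := I.θ₂ * √(I.c.Lll / I.c.LD) * R with hW
  have hsq : √(I.c.Lll / I.c.LD) ^ 2 = I.c.Lll / I.c.LD := Real.sq_sqrt (by positivity)
  have hW2 : W ^ 2 = I.θ₂ ^ 2 * (I.c.Lll / I.c.LD) * R ^ 2 := by
    rw [hW, mul_pow, mul_pow, hsq]
  have hθ0 : 0 < I.θ₂ := by linarith
  have hW1 : 1 ≤ W := by
    have h1 : 1 ≤ √(I.c.Lll / I.c.LD) * R := by
      rw [hR, ← Real.sqrt_mul (by positivity), Real.one_le_sqrt]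
      have e : I.c.Lll / I.c.LD * (I.c.LD * q / ε) = I.c.Lll * q / ε := by field_simp
      rw [e, le_div_iff₀ hε]
      nlinarith
    rw [hW, mul_assoc]
    exact one_le_mul_of_one_le_of_one_le hθ h1
  -- The two dual solves of iteration `k` use `ρ_k` and `ρ_{k+1}`, hence `j ≤ k + 1`.
  have hsolve : ∀ k < K, ∀ j ≤ k + 1, ∀ start x,
      (((solveDual I (run I j).ρ (I.η k) start x).calls : ℕ) : ℝ) ≤ 24 * I.P.n * (ℓ * W) := by
    intro k hk j hj start x
    have hk1 : (k : ℝ) + 1 ≤ K := by exact_mod_cast hk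
    have hj1 : (j : ℝ) ≤ k + 1 := by exact_mod_cast hj
    have hk3 : (k : ℝ) + 3 ≤ 11 * (I.c.LD * q) / ε := by
      rw [mul_div_assoc, ← hR2]; nlinarith
    have hρ := (run_spec hI hc hθ₁ hθ hε hp j).2.2.1
    have hjj : ((j : ℝ) + 1) * (j + 2) ≤ 121 * R ^ 2 := by
      have h1 : (j : ℝ) + 1 ≤ 11 * R := by linarith
      have h2 : (j : ℝ) + 2 ≤ 11 * R := by linarith
      have := mul_le_mul h1 h2 (by positivity) (by positivity)
      linarith
    -- Here `2L/μ` is at most `(121/8) W²`, and `121/8 ≤ 16`.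
    have hit := apgIterations_le_of_threshold (k := k) (X := 4 * W) (μ := (run I j).ρ / I.θ₂ ^ 2)
      hL (by rw [hρ]; positivity) (by positivity) hε Metric.diam_nonneg hD hk3 hlog hthr
      (by positivity) (by
        rw [mul_pow, hW2, hρ]
        have e : 2 * I.c.Lll / (16 * I.c.LD / (((j : ℝ) + 1) * (j + 2)) / I.θ₂ ^ 2)
          = I.θ₂ ^ 2 * (I.c.Lll / I.c.LD) * ((((j : ℝ) + 1) * (j + 2)) / 8) := by
            field_simp; ring
        rw [e]
        have : 0 ≤ I.θ₂ ^ 2 * (I.c.Lll / I.c.LD) := by positivity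
        nlinarith [mul_le_mul_of_nonneg_left hjj this, mul_nonneg this (sq_nonneg R)])
    rw [solveDual_calls, hp.η_eq]
    push_cast
    have hℓW : ℓ ≤ ℓ * W := le_mul_of_one_le_right (by linarith) hW1
    calc 2 * (I.P.n : ℝ) * _ ≤ 2 * I.P.n * (12 * (ℓ * W)) := by
          gcongr
          refine hit.trans ?_
          linarith
      _ = _ := by ring
  refine (dualCalls_run_le I (fun k hk => hsolve k hk k (by omega) _ _)
    (fun k hk => hsolve k hk (k + 1) le_rfl _ _)).trans ?_
  have hR2W : √(I.c.Lll / I.c.LD) * R ^ 2 = q * (√(I.c.Lll * I.c.LD) / ε) := by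
    have e : √(I.c.Lll * I.c.LD) = √(I.c.Lll / I.c.LD) * I.c.LD := by
      rw [show I.c.Lll * I.c.LD = I.c.Lll / I.c.LD * I.c.LD ^ 2 by field_simp,
        Real.sqrt_mul (by positivity), Real.sqrt_sq hLD.le]
    rw [hR2, e]; ring
  calc (K : ℝ) * (2 * (24 * I.P.n * (ℓ * W))) ≤ 9 * R * (2 * (24 * I.P.n * (ℓ * W))) := by gcongr
    _ = 432 * I.θ₂ * (√(I.c.Lll / I.c.LD) * R ^ 2) * (I.P.n * ℓ) := by rw [hW]; ring
    _ = 432 * I.θ₂ * q * (I.P.n * (√(I.c.Lll * I.c.LD) / ε) * ℓ) := by rw [hR2W]; ring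
    _ ≤ _ := by gcongr; norm_num

end Complexity

end IPDS

/-! ### Assembling the complexity theorem -/

theorem mainTheorem2 :
    ∃ C : ℝ, 0 < C ∧
      ∀ (c : IPDS.Constants) (b D Δ₀ θ₁ θ₂ : ℝ),
        c.Valid → 0 ≤ b → 0 ≤ D → 0 ≤ Δ₀ → 1 ≤ θ₁ → 1 ≤ θ₂ →
        ∃ ε₀ : ℝ, 0 < ε₀ ∧
          ∀ (E₁ : Type u) [NormedAddCommGroup E₁] [NormedSpace ℝ E₁] [FiniteDimensional ℝ E₁]
            (E₂ : Type v) [NormedAddCommGroup E₂] [NormedSpace ℝ E₂] [FiniteDimensional ℝ E₂]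
            (I : IPDS.Input E₁ E₂) (ε : ℝ),
            I.Admissible → I.c = c → I.θ₁ = θ₁ → I.θ₂ = θ₂ →
            Metric.diam I.P.X ≤ D → Metric.diam I.P.Λ ≤ D →
            (∀ l ∈ I.P.Λ, |I.P.ω l| ≤ b) →
            I.P.gap I.x₀ I.l₀ ≤ Δ₀ →
            0 < ε → ε ≤ ε₀ → I.HasParameters ε →
            IPDS.SubproblemsSolved I ∧
            ∃ K : ℕ,
              (IPDS.run I K).x ∈ I.P.X ∧ (IPDS.run I K).l ∈ I.P.Λ ∧
              I.P.gap (IPDS.run I K).x (IPDS.run I K).l ≤ ε ∧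
              ((IPDS.run I K).primalCalls : ℝ) ≤
                C * θ₁ * √(1 + b + Δ₀ / c.LD) *
                  (I.P.n * √(c.kappa * c.LD / ε) * Real.log ((c.L + c.Lxx) * c.LD / ε)) ∧
              (0 < c.Lll →
                ((IPDS.run I K).dualCalls : ℝ) ≤
                  C * θ₂ * (1 + b + Δ₀ / c.LD) *
                    (I.P.n * (√(c.Lll * c.LD) / ε) * Real.log (c.Lll * c.LD / ε))) := by

  refine ⟨1000, by norm_num, fun c b D Δ₀ θ₁ θ₂ hc hb hD hΔ₀ hθ₁ hθ₂ => ?_⟩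
  have hLD := hc.LD_pos
  have hL : 0 < c.L + c.Lxx := by linarith [hc.mu_pos, hc.mu_le, hc.Lxx_nonneg]
  set q := 1 + b + Δ₀ / c.LD with hq
  have hq1 : 1 ≤ q := by
    have : 0 ≤ Δ₀ / c.LD := by positivity
    linarith
  obtain ⟨ε₁, hε₁, h₁⟩ := IPDS.exists_threshold (mul_pos hL hLD)
    (by positivity : 0 ≤ (c.L + c.Lxx) * θ₁ ^ 2 * D ^ 2 * (11 * (c.LD * q)))
  obtain ⟨ε₂, hε₂, h₂⟩ : ∃ ε₂ : ℝ, 0 < ε₂ ∧ ∀ ε, 0 < ε → ε ≤ ε₂ → 0 < c.Lll →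
      ε ≤ c.Lll ∧ 1 ≤ Real.log (c.Lll * c.LD / ε) ∧
      c.Lll * θ₂ ^ 2 * D ^ 2 * (11 * (c.LD * q)) * ε ^ 2 ≤ (c.Lll * c.LD) ^ 4 := by
    by_cases hl : 0 < c.Lll
    · obtain ⟨ε₂, hε₂, h₂⟩ := IPDS.exists_threshold (mul_pos hl hLD)
        (by positivity : 0 ≤ c.Lll * θ₂ ^ 2 * D ^ 2 * (11 * (c.LD * q)))
      exact ⟨min ε₂ c.Lll, by positivity, fun ε hε h _ =>
        ⟨h.trans (min_le_right _ _), h₂ ε hε (h.trans (min_le_left _ _))⟩⟩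
    · exact ⟨1, one_pos, fun _ _ _ h => absurd h hl⟩
  -- The bound `ε ≤ LD` ensures `R ≥ 1`, so rounding `8R` up costs at most one more `R`.
  refine ⟨min c.LD (min ε₁ ε₂), by positivity, ?_⟩
  intro E₁ _ _ _ E₂ _ _ _ I ε hI hIc hI₁ hI₂ hDX hDΛ hω hgap hε hεle hp
  subst hIc hI₁ hI₂
  have hεLD := hεle.trans (min_le_left _ _)
  obtain ⟨hlog₁, hthr₁⟩ := h₁ ε hε (hεle.trans ((min_le_right _ _).trans (min_le_left _ _)))
  have h₂' := h₂ ε hε (hεle.trans ((min_le_right _ _).trans (min_le_right _ _)))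
  have hR1 : 1 ≤ √(I.c.LD * q / ε) := by
    rw [Real.one_le_sqrt, le_div_iff₀ hε]
    nlinarith
  have hR2 : √(I.c.LD * q / ε) ^ 2 * ε = I.c.LD * q := by
    rw [Real.sq_sqrt (by positivity)]; field_simp
  set R := √(I.c.LD * q / ε) with hR
  set K := ⌈8 * R⌉₊ with hKdef
  have hK8 : 8 * R ≤ K := Nat.le_ceil _
  have hK9 : (K : ℝ) ≤ 9 * R := by
    have := Nat.ceil_lt_add_one (by positivity : 0 ≤ 8 * R)
    linarith
  obtain ⟨hx, hl, -, -⟩ := IPDS.run_spec hI hc hθ₁ hθ₂ hε hp K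
  refine ⟨IPDS.subproblemsSolved hI hc hθ₁ hθ₂ hε hp, K, hx, hl,
    IPDS.gap_run_le hI hc hθ₁ hθ₂ hε hp hω hgap ?_,
    IPDS.primalCalls_le hc hI.problem.n_pos hθ₁ hp hε hDX (by linarith) hR hR1 hK9 hlog₁ hthr₁,
    fun hll => ?_⟩
  -- The factor `8` comes from here: `64 R² ε = 64 (LD + LD b + Δ₀)` must dominate `4 Δ₀ + 64 LD b`.
  · have h64 : (8 * R) ^ 2 ≤ ((K : ℝ) + 1) * (K + 2) := by nlinarith
    have h3 := mul_le_mul_of_nonneg_right h64 hε.le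
    have h4 : I.c.LD * q = I.c.LD + I.c.LD * b + Δ₀ := by rw [hq]; field_simp
    have h5 : 0 ≤ I.c.LD * b := by positivity
    nlinarith
  · obtain ⟨hεl, hlog₂, hthr₂⟩ := h₂' hll
    exact IPDS.dualCalls_le hI hc hθ₁ hθ₂ hp hε hDΛ hq1 hR hR1 hK9 hll hεl hlog₂ hthr₂
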